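/- Let $I$ be a finite set, $A=(a_{ij})_{i,j\in I}$ an integer matrix with $a_{ii}\in\{2,0,-2,-4,\dots\}$ and $a_{ij}\le 0$ for $i\ne j$, and $r_i$ $(i\in I)$ positive integers with $r_ia_{ij}=r_ja_{ji}$; put $i\cdot j=r_ia_{ij}$, $I^+=\{i: a_{ii}=2\}$ and $I^-=\{i:a_{ii}\le 0\}$. Let $\mathbb K$ be an algebraically closed field, let $\nu=\sum_i\nu_i i\in\mathbb N[I]$, $n=\sum_i\nu_i$, and let $\mathrm{Seq}(\nu)$ be the set of sequences $\mathbf i=i_1\cdots i_n$ in $I$ with $i_1+\dots+i_n=\nu$, on which $s_k=(k,k+1)$ acts by permuting positions. Let $R(\nu)$ be the quiver Hecke algebra of this datum: the unital associative $\mathbb K$-algebra generated by $1_{\mathbf i}$, $x_{k,\mathbf i}$ $(1\le k\le n)$, $\tau_{k,\mathbf i}$ $(1\le k<n)$, $\mathbf i\in \mathrm{Seq}(\nu)$, such that the $1_{\mathbf i}$ are orthogonal idempotents with sum $1$, $x_{k,\mathbf i}=1_{\mathbf i}x_{k,\mathbf i}1_{\mathbf i}$, $\tau_{k,\mathbf i}=1_{s_k\mathbf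 i}\tau_{k,\mathbf i}1_{\mathbf i}$, and such that, with $x_k=\sum_{\mathbf i}x_{k,\mathbf i}$, $\tau_k=\sum_{\mathbf i}\tau_{k,\mathbf i}$, - $x_kx_l=x_lx_k$; $\ \tau_kx_l=x_l\tau_k$ if $l\ne k,k+1$; $\ \tau_k\tau_l=\tau_l\tau_k$ if $|k-l|>1$; - $\tau_k^2 1_{\mathbf i}=0$ if $i_k=i_{k+1}$; $\ \tau_k^21_{\mathbf i}=1_{\mathbf i}$ if $i_k\ne i_{k+1}$ and $i_k\cdot i_{k+1}=0$; $\ \tau_k^21_{\mathbf i}=\bigl(x_k^{-a_{ij}}+x_{k+1}^{-a_{ji}}\bigr)1_{\mathbf i}$ if $i=i_k\neq j=i_{k+1}$ and $i\cdot j\neq 0$; - $(x_k\tau_k-\tau_kx_{k+1})1_{\mathbf i}=(\tau_kx_k-x_{k+1}\tau_k)1_{\mathbf i}$, and this element equals $1_{\mathbf i}$ if $i_k=i_{k+1}\in I^+$ and $0$ otherwise; - $(\tau_k\tau_{k+1}\tau_k-\tau_{k+1}\tau_k\tau_{k+1})1_{\mathbf i}=\sum_{c=0}^{-a_{ij}-1}x_k^{c}x_{k+2}^{-a_{ij}-1-c}1_{\mathbf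 i}$ if $i=i_k=i_{k+2}\in I^+$, $j=i_{k+1}\ne i$ and $i\cdot j\neq 0$, and it equals $0$ otherwise. It is $\mathbb Z$-graded by $\deg 1_{\mathbf i}=0$, $\deg x_{k,\mathbf i}=2r_{i_k}$, $\deg\tau_{k,\mathbf i}=-i_k\cdot i_{k+1}$. Let $G_0(R(\nu))$ be the Grothendieck group of the category of finite-dimensional $\mathbb Z$-graded left $R(\nu)$-modules with grading-preserving homomorphisms. It is a $\mathbb Z[q,q^{-1}]$-module via $q[M]=[M\{1\}]$, where $M\{m\}_d=M_{d-m}$. Let $\mathrm{Ch}\,M=\sum_{\mathbf i\in\mathrm{Seq}(\nu)}\Bigl(\sum_{d\in\mathbb Z}\dim (1_{\mathbf i}M)_d\,q^d\Bigr)\mathbf i$ in the free $\mathbb Z[q,q^{-1}]$-module $\mathbb Z[q,q^{-1}]\mathrm{Seq}(\nu)$. **Theorem.** The $\mathbb Z[q,q^{-1}]$-linear map $\mathrm{Ch}:G_0(R(\nu))\to\mathbb Z[q,q^{-1}]\mathrm{Seq}(\nu)$, $[M]\mapsto \mathrm{Ch}\,M$, is injective. Moreover, if $(S_b)_{b\in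 B}$ is any family of finite-dimensional graded irreducible $R(\nu)$-modules that are pairwise non-isomorphic even up to degree shift, then the characters $\mathrm{Ch}\,S_b$ $(b\in B)$ are linearly independent over $\mathbb Z[q,q^{-1}]$. -/

import Mathlib

open scoped LaurentPolynomial

universe u v

/-- A Borcherds-Cartan datum with index set `I`: a symmetrizable Borcherds-Cartan matrix `a`
together with a symmetrizing diagonal `r`.  The symmetric bilinear form is determined on the basis
by `i · j = r i * a i j`, see `dot`. -/
structure BorcherdsCartanDatum (I : Type v) where
  a : Matrix I I ℤ
  r : I → ℤ
  diag : ∀ i, a i i = 2 ∨ (a i i ≤ 0 ∧ Even (a i i))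
  offDiag : ∀ i j, i ≠ j → a i j ≤ 0
  r_pos : ∀ i, 0 < r i
  symm : ∀ i j, r i * a i j = r j * a j i

namespace BorcherdsCartanDatum

variable {I : Type v}

/-- The value `i · j` of the bilinear form. -/
def dot (D : BorcherdsCartanDatum I) (i j : I) : ℤ := D.r i * D.a i j

/-- `i ∈ I⁺`, that is, `i` is a real index. -/
def IsReal (D : BorcherdsCartanDatum I) (i : I) : Prop := D.a i i = 2

/-- `i ∈ I⁻`, that is, `i` is an imaginary index. -/
def IsImaginary (D : BorcherdsCartanDatum I) (i : I) : Prop := D.a i i ≤ 0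

end BorcherdsCartanDatum

namespace QuiverHecke

section Sequences

variable {I : Type v} [DecidableEq I]

/-- The sequences `i₁ i₂ … iₙ` in `I` with `i₁ + … + iₙ = ν` (so `n` is the height of `ν`). -/
def SeqOf (n : ℕ) (ν : I →₀ ℕ) : Type v :=
  {i : Fin n → I // ∀ j, (Finset.univ.filter fun k => i k = j).card = ν j}

variable {n : ℕ} {ν : I →₀ ℕ}

instance : DecidableEq (SeqOf n ν) := inferInstanceAs (DecidableEq (Subtype _))

instance [Fintype I] : Fintype (SeqOf n ν) := inferInstanceAs (Fintype (Subtype _))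

instance : CoeFun (SeqOf n ν) (fun _ => Fin n → I) := ⟨fun i => i.1⟩

/-- The simple transposition `s_k` (positions `k`, `k + 1`, counted from `0`), acting on
sequences. -/
def SeqOf.swap (k : ℕ) (hk : k + 1 < n) (i : SeqOf n ν) : SeqOf n ν :=
  ⟨i.1 ∘ Equiv.swap (⟨k, by omega⟩ : Fin n) ⟨k + 1, hk⟩, fun j => by
    rw [← i.2 j]
    refine Finset.card_bij'
      (fun a _ => Equiv.swap (⟨k, by omega⟩ : Fin n) ⟨k + 1, hk⟩ a)
      (fun a _ => Equiv.swap (⟨k, by omega⟩ : Fin n) ⟨k + 1, hk⟩ a) ?_ ?_ ?_ ?_ <;> simp⟩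

end Sequences

section Algebra

variable {I : Type v} [DecidableEq I] [Fintype I]

/-- The diagrammatic generators: `e i` is the idempotent `1_i` (vertical strands coloured by `i`),
`x k i` is `1_i` with a dot on strand `k`, and `t k hk i` is the crossing of the strands `k`, `k+1`
with bottom sequence `i` and top sequence `s_k i`. -/
inductive Gen (n : ℕ) (ν : I →₀ ℕ) : Type v
  | e (i : SeqOf n ν) : Gen n ν
  | x (k : Fin n) (i : SeqOf n ν) : Gen n ν
  | t (k : ℕ) (hk : k + 1 < n) (i : SeqOf n ν) : Gen n ν

variable (D : BorcherdsCartanDatum I)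

/-- The degree of a generator. -/
def Gen.deg {n : ℕ} {ν : I →₀ ℕ} : Gen n ν → ℤ
  | .e _ => 0
  | .x k i => 2 * D.r (i k)
  | .t k hk i => - D.dot (i ⟨k, by omega⟩) (i ⟨k + 1, hk⟩)

variable (K : Type u) [Field K]

section Free

variable {n : ℕ} {ν : I →₀ ℕ}

/-- The generator `1_i` in the free algebra. -/
abbrev fe (i : SeqOf n ν) : FreeAlgebra K (Gen n ν) := FreeAlgebra.ι K (.e i)
/-- The generator `x_{k,i}` in the free algebra. -/
abbrev fx (k : Fin n) (i : SeqOf n ν) : FreeAlgebra K (Gen n ν) := FreeAlgebra.ι K (.x k i)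
/-- The generator `τ_{k,i}` in the free algebra. -/
abbrev ft (k : ℕ) (hk : k + 1 < n) (i : SeqOf n ν) : FreeAlgebra K (Gen n ν) :=
  FreeAlgebra.ι K (.t k hk i)

end Free

open SeqOf in
/-- The defining relations of `R(ν)`.  A product `a * b` is the diagram `a` on top of `b`.
The first two groups encode concatenation of diagrams and planar isotopy; then come the
local relations. -/
inductive Rel (n : ℕ) (ν : I →₀ ℕ) :
    FreeAlgebra K (Gen n ν) → FreeAlgebra K (Gen n ν) → Prop
  -- concatenation of diagrams
  | e_mul_self (i : SeqOf n ν) : Rel n ν (fe K i * fe K i) (fe K i)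
  | e_mul_ne (i j : SeqOf n ν) (h : i ≠ j) : Rel n ν (fe K i * fe K j) 0
  | sum_e : Rel n ν (∑ i, fe K i) 1
  | e_mul_x (k : Fin n) (i : SeqOf n ν) : Rel n ν (fe K i * fx K k i) (fx K k i)
  | x_mul_e (k : Fin n) (i : SeqOf n ν) : Rel n ν (fx K k i * fe K i) (fx K k i)
  | e_mul_t (k : ℕ) (hk : k + 1 < n) (i : SeqOf n ν) :
      Rel n ν (fe K (swap k hk i) * ft K k hk i) (ft K k hk i)
  | t_mul_e (k : ℕ) (hk : k + 1 < n) (i : SeqOf n ν) :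
      Rel n ν (ft K k hk i * fe K i) (ft K k hk i)
  -- planar isotopy
  | x_comm (k l : Fin n) (i : SeqOf n ν) :
      Rel n ν (fx K k i * fx K l i) (fx K l i * fx K k i)
  | x_t_far (k : ℕ) (hk : k + 1 < n) (l : Fin n) (hl : l.1 ≠ k) (hl' : l.1 ≠ k + 1)
      (i : SeqOf n ν) :
      Rel n ν (fx K l (swap k hk i) * ft K k hk i) (ft K k hk i * fx K l i)
  | t_t_far (k l : ℕ) (hk : k + 1 < n) (hl : l + 1 < n) (hkl : k + 1 < l) (i : SeqOf n ν) :
      Rel n ν (ft K k hk (swap l hl i) * ft K l hl i) (ft K l hl (swap k hk i) * ft K k hk i)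
  -- double crossings
  | t_sq_same (k : ℕ) (hk : k + 1 < n) (i : SeqOf n ν)
      (h : i ⟨k, by omega⟩ = i ⟨k + 1, hk⟩) :
      Rel n ν (ft K k hk (swap k hk i) * ft K k hk i) 0
  | t_sq_orth (k : ℕ) (hk : k + 1 < n) (i : SeqOf n ν)
      (h : i ⟨k, by omega⟩ ≠ i ⟨k + 1, hk⟩)
      (h0 : D.dot (i ⟨k, by omega⟩) (i ⟨k + 1, hk⟩) = 0) :
      Rel n ν (ft K k hk (swap k hk i) * ft K k hk i) (fe K i)
  | t_sq_adj (k : ℕ) (hk : k + 1 < n) (i : SeqOf n ν)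
      (h : i ⟨k, by omega⟩ ≠ i ⟨k + 1, hk⟩)
      (h0 : D.dot (i ⟨k, by omega⟩) (i ⟨k + 1, hk⟩) ≠ 0) :
      Rel n ν (ft K k hk (swap k hk i) * ft K k hk i)
        ((fx K ⟨k, by omega⟩ i ^ (- D.a (i ⟨k, by omega⟩) (i ⟨k + 1, hk⟩)).toNat
          + fx K ⟨k + 1, hk⟩ i ^ (- D.a (i ⟨k + 1, hk⟩) (i ⟨k, by omega⟩)).toNat) * fe K i)
  -- a dot sliding through a crossing
  | x_t_real (k : ℕ) (hk : k + 1 < n) (i : SeqOf n ν)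
      (h : i ⟨k, by omega⟩ = i ⟨k + 1, hk⟩) (hr : D.IsReal (i ⟨k, by omega⟩)) :
      Rel n ν (fx K ⟨k, by omega⟩ (swap k hk i) * ft K k hk i
        - ft K k hk i * fx K ⟨k + 1, hk⟩ i) (fe K i)
  | t_x_real (k : ℕ) (hk : k + 1 < n) (i : SeqOf n ν)
      (h : i ⟨k, by omega⟩ = i ⟨k + 1, hk⟩) (hr : D.IsReal (i ⟨k, by omega⟩)) :
      Rel n ν (ft K k hk i * fx K ⟨k, by omega⟩ i
        - fx K ⟨k + 1, hk⟩ (swap k hk i) * ft K k hk i) (fe K i)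
  | x_t_imag (k : ℕ) (hk : k + 1 < n) (i : SeqOf n ν)
      (h : i ⟨k, by omega⟩ = i ⟨k + 1, hk⟩) (hi : D.IsImaginary (i ⟨k, by omega⟩)) :
      Rel n ν (fx K ⟨k, by omega⟩ (swap k hk i) * ft K k hk i)
        (ft K k hk i * fx K ⟨k + 1, hk⟩ i)
  | t_x_imag (k : ℕ) (hk : k + 1 < n) (i : SeqOf n ν)
      (h : i ⟨k, by omega⟩ = i ⟨k + 1, hk⟩) (hi : D.IsImaginary (i ⟨k, by omega⟩)) :
      Rel n ν (ft K k hk i * fx K ⟨k, by omega⟩ i)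
        (fx K ⟨k + 1, hk⟩ (swap k hk i) * ft K k hk i)
  | x_t_ne (k : ℕ) (hk : k + 1 < n) (i : SeqOf n ν)
      (h : i ⟨k, by omega⟩ ≠ i ⟨k + 1, hk⟩) :
      Rel n ν (fx K ⟨k, by omega⟩ (swap k hk i) * ft K k hk i)
        (ft K k hk i * fx K ⟨k + 1, hk⟩ i)
  | t_x_ne (k : ℕ) (hk : k + 1 < n) (i : SeqOf n ν)
      (h : i ⟨k, by omega⟩ ≠ i ⟨k + 1, hk⟩) :
      Rel n ν (ft K k hk i * fx K ⟨k, by omega⟩ i)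
        (fx K ⟨k + 1, hk⟩ (swap k hk i) * ft K k hk i)
  -- triple crossings
  | braid_special (k : ℕ) (hk : k + 2 < n) (i : SeqOf n ν)
      (h : i ⟨k, by omega⟩ = i ⟨k + 2, hk⟩) (hr : D.IsReal (i ⟨k, by omega⟩))
      (hne : i ⟨k, by omega⟩ ≠ i ⟨k + 1, by omega⟩)
      (h0 : D.dot (i ⟨k, by omega⟩) (i ⟨k + 1, by omega⟩) ≠ 0) :
      Rel n ν
        (ft K k (by omega) (swap (k + 1) hk (swap k (by omega) i))
            * ft K (k + 1) hk (swap k (by omega) i) * ft K k (by omega) i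
          - ft K (k + 1) hk (swap k (by omega) (swap (k + 1) hk i))
            * ft K k (by omega) (swap (k + 1) hk i) * ft K (k + 1) hk i)
        (∑ c ∈ Finset.range (- D.a (i ⟨k, by omega⟩) (i ⟨k + 1, by omega⟩)).toNat,
          fx K ⟨k, by omega⟩ i ^ c
            * fx K ⟨k + 2, hk⟩ i ^
              ((- D.a (i ⟨k, by omega⟩) (i ⟨k + 1, by omega⟩)).toNat - 1 - c)
            * fe K i)
  | braid (k : ℕ) (hk : k + 2 < n) (i : SeqOf n ν)
      (h : ¬ (i ⟨k, by omega⟩ = i ⟨k + 2, hk⟩ ∧ D.IsReal (i ⟨k, by omega⟩) ∧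
        i ⟨k, by omega⟩ ≠ i ⟨k + 1, by omega⟩ ∧
        D.dot (i ⟨k, by omega⟩) (i ⟨k + 1, by omega⟩) ≠ 0)) :
      Rel n ν
        (ft K k (by omega) (swap (k + 1) hk (swap k (by omega) i))
            * ft K (k + 1) hk (swap k (by omega) i) * ft K k (by omega) i)
        (ft K (k + 1) hk (swap k (by omega) (swap (k + 1) hk i))
            * ft K k (by omega) (swap (k + 1) hk i) * ft K (k + 1) hk i)

variable (n : ℕ) (ν : I →₀ ℕ)

/-- The algebra `R(ν)`, where `n` is the height of `ν`. -/
def R : Type (max u v) := RingQuot (Rel D K n ν)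

noncomputable instance : Ring (R D K n ν) := inferInstanceAs (Ring (RingQuot _))

noncomputable instance : Algebra K (R D K n ν) := inferInstanceAs (Algebra K (RingQuot _))

variable {n ν}

/-- The image of a generator in `R(ν)`. -/
noncomputable def R.gen (g : Gen n ν) : R D K n ν :=
  RingQuot.mkAlgHom K (Rel D K n ν) (FreeAlgebra.ι K g)

/-- The idempotent `1_i` of `R(ν)`. -/
noncomputable def R.e (i : SeqOf n ν) : R D K n ν := R.gen D K (.e i)

variable (n ν)

/-- The component of degree `d` of `R(ν)`: the span of the products of generators (diagrams)
whose degrees add up to `d`. -/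
noncomputable def R.grade (d : ℤ) : Submodule K (R D K n ν) :=
  Submodule.span K {y | ∃ w : List (Gen n ν),
    (w.map (Gen.deg D)).sum = d ∧ y = (w.map (R.gen D K)).prod}

variable {n ν} in
lemma R.e_mem_grade (i : SeqOf n ν) : R.e D K i ∈ R.grade D K n ν 0 :=
  Submodule.subset_span ⟨[.e i], by simp [Gen.deg], by simp [R.e]⟩

end Algebra

section Modules

variable {I : Type v} [DecidableEq I] [Fintype I]

/-- A finite-dimensional graded left `R(ν)`-module, that is, an object of `R(ν)-fMod`. -/
structure GrMod (D : BorcherdsCartanDatum I) (K : Type u) [Field K] (n : ℕ) (ν : I →₀ ℕ) where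
  carrier : Type u
  [addCommGroup : AddCommGroup carrier]
  [moduleK : Module K carrier]
  [module : Module (R D K n ν) carrier]
  [isScalarTower : IsScalarTower K (R D K n ν) carrier]
  [finite : Module.Finite K carrier]
  /-- The homogeneous components. -/
  deg : ℤ → Submodule K carrier
  isInternal : DirectSum.IsInternal deg
  smul_mem : ∀ (d m : ℤ) (a : R D K n ν) (x : carrier),
    a ∈ R.grade D K n ν d → x ∈ deg m → a • x ∈ deg (d + m)

attribute [instance] GrMod.addCommGroup GrMod.moduleK GrMod.module GrMod.isScalarTower
  GrMod.finite

variable {D : BorcherdsCartanDatum I} {K : Type u} [Field K] {n : ℕ} {ν : I →₀ ℕ}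

namespace GrMod

/-- The shifted module `M{m}`, with `(M{m})_d = M_{d-m}`. -/
def shift (M : GrMod D K n ν) (m : ℤ) : GrMod D K n ν where
  carrier := M.carrier
  deg d := M.deg (d - m)
  isInternal := by
    have h := M.isInternal
    rw [DirectSum.isInternal_submodule_iff_iSupIndep_and_iSup_eq_top] at h ⊢
    refine ⟨h.1.comp (f := fun d => d - m) (sub_left_injective), ?_⟩
    rw [← h.2]
    exact (Equiv.subRight m).iSup_congr fun _ => rfl
  smul_mem d l a x ha hx := by
    have := M.smul_mem d (l - m) a x ha hx
    rwa [← add_sub_assoc] at this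

lemma shift_zero (M : GrMod D K n ν) : M.shift 0 = M := by
  cases M; simp [shift]

lemma shift_shift (M : GrMod D K n ν) (a b : ℤ) : (M.shift a).shift b = M.shift (a + b) := by
  cases M; simp [shift, sub_sub, add_comm]

/-- `0 → M' → M → M'' → 0` is a short exact sequence with grading-preserving maps. -/
structure IsShortExact {M' M M'' : GrMod D K n ν}
    (f : M'.carrier →ₗ[R D K n ν] M.carrier) (g : M.carrier →ₗ[R D K n ν] M''.carrier) :
    Prop where
  f_deg : ∀ d, ∀ x ∈ M'.deg d, f x ∈ M.deg d
  g_deg : ∀ d, ∀ x ∈ M.deg d, g x ∈ M''.deg d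
  injective : Function.Injective f
  exact : Function.Exact f g
  surjective : Function.Surjective g

/-- `M` and `N` are isomorphic as graded modules. -/
def IsIso (M N : GrMod D K n ν) : Prop :=
  ∃ f : M.carrier ≃ₗ[R D K n ν] N.carrier, ∀ d x, f x ∈ N.deg d ↔ x ∈ M.deg d

/-- `M` and `N` are isomorphic as graded modules up to a degree shift. -/
def IsIsoUpToShift (M N : GrMod D K n ν) : Prop := ∃ m : ℤ, IsIso M (N.shift m)

/-- `N` is a graded submodule of `M`: it is the sum of its homogeneous parts. -/
def IsGradedSubmodule (M : GrMod D K n ν) (N : Submodule (R D K n ν) M.carrier) : Prop :=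
  N.restrictScalars K ≤ ⨆ d, N.restrictScalars K ⊓ M.deg d

/-- `M` is gr-irreducible: it is nonzero and has no graded submodules but `0` and itself. -/
def IsGrIrreducible (M : GrMod D K n ν) : Prop :=
  Nontrivial M.carrier ∧ ∀ N, M.IsGradedSubmodule N → N = ⊥ ∨ N = ⊤

/-- The component of degree `d` of the graded vector space `1_i M`. -/
noncomputable def piece (M : GrMod D K n ν) (i : SeqOf n ν) (d : ℤ) : Submodule K M.carrier :=
  (M.deg d).map (Algebra.lsmul K K M.carrier (R.e D K i))

/-- The graded dimension of `1_i M`. -/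
noncomputable def gdim (M : GrMod D K n ν) (i : SeqOf n ν) : ℤ[T;T⁻¹] :=
  ∑ᶠ d : ℤ, (Module.finrank K (M.piece i d) : ℤ[T;T⁻¹]) * LaurentPolynomial.T d

/-- The character `Ch M = ∑_i gdim(1_i M) i`. -/
noncomputable def character (M : GrMod D K n ν) : SeqOf n ν →₀ ℤ[T;T⁻¹] :=
  ∑ i, Finsupp.single i (M.gdim i)

/-- The projection onto a homogeneous component. -/
lemma exists_proj (M : GrMod D K n ν) (d : ℤ) : ∃ p : M.carrier →ₗ[K] M.carrier,
    (∀ x, p x ∈ M.deg d) ∧ (∀ x ∈ M.deg d, p x = x) ∧ ∀ c ≠ d, ∀ x ∈ M.deg c, p x = 0 := by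
  classical
  let _ := M.isInternal.chooseDecomposition
  refine ⟨(M.deg d).subtype ∘ₗ DirectSum.component K ℤ (fun c => M.deg c) d ∘ₗ
    (DirectSum.decomposeLinearEquiv M.deg).toLinearMap, fun x => ?_, fun x hx => ?_,
    fun c hc x hx => ?_⟩
  · simp
  · simp only [LinearMap.comp_apply, LinearEquiv.coe_coe, DirectSum.decomposeLinearEquiv_apply,
      DirectSum.decompose_of_mem M.deg hx, ← DirectSum.apply_eq_component]
    rw [DirectSum.of_eq_same]
    rfl
  · simp only [LinearMap.comp_apply, LinearEquiv.coe_coe, DirectSum.decomposeLinearEquiv_apply,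
      DirectSum.decompose_of_mem M.deg hx, ← DirectSum.apply_eq_component]
    rw [DirectSum.of_eq_of_ne _ _ _ hc.symm]
    simp

lemma eq_of_eq_on_deg {V : Type*} [AddCommGroup V] [Module K V] (M : GrMod D K n ν)
    (f g : M.carrier →ₗ[K] V) (h : ∀ d, ∀ x ∈ M.deg d, f x = g x) : f = g := by
  ext x
  have hx : x ∈ ⨆ d, M.deg d := by
    rw [M.isInternal.submodule_iSup_eq_top]; trivial
  induction hx using Submodule.iSup_induction' with
  | mem d x hx => exact h d x hx
  | zero => simp
  | add x y _ _ hx hy => simp [hx, hy]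

lemma e_smul_mem (M : GrMod D K n ν) (i : SeqOf n ν) (d : ℤ) (x : M.carrier)
    (hx : x ∈ M.deg d) : R.e D K i • x ∈ M.deg d := by
  simpa using M.smul_mem 0 d _ x (R.e_mem_grade D K i) hx

lemma e_mul_e (i : SeqOf n ν) : R.e D K i * R.e D K i = R.e D K i := by
  have := RingQuot.mkAlgHom_rel K (Rel.e_mul_self (D := D) (K := K) i)
  rw [map_mul] at this
  exact this

lemma mem_piece (M : GrMod D K n ν) (i : SeqOf n ν) (d : ℤ) (x : M.carrier) :
    x ∈ M.piece i d ↔ x ∈ M.deg d ∧ R.e D K i • x = x := by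
  constructor
  · rintro ⟨y, hy, rfl⟩
    refine ⟨M.e_smul_mem i d y hy, ?_⟩
    simp [smul_smul, e_mul_e]
  · rintro ⟨h, h'⟩
    exact ⟨x, h, h'⟩

lemma finrank_piece {M' M M'' : GrMod D K n ν}
    {f : M'.carrier →ₗ[R D K n ν] M.carrier} {g : M.carrier →ₗ[R D K n ν] M''.carrier}
    (h : IsShortExact f g) (i : SeqOf n ν) (d : ℤ) :
    Module.finrank K (M.piece i d)
      = Module.finrank K (M'.piece i d) + Module.finrank K (M''.piece i d) := by
  obtain ⟨p', hp1', hp2', hp3'⟩ := M'.exists_proj d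
  obtain ⟨p, hp1, hp2, hp3⟩ := M.exists_proj d
  obtain ⟨p'', hp1'', hp2'', hp3''⟩ := M''.exists_proj d
  have cf : p ∘ₗ f.restrictScalars K = f.restrictScalars K ∘ₗ p' := by
    refine M'.eq_of_eq_on_deg _ _ fun c x hx => ?_
    by_cases hc : c = d
    · subst hc
      simp [hp2' x hx, hp2 _ (h.f_deg _ _ hx)]
    · simp [hp3' c hc x hx, hp3 c hc _ (h.f_deg _ _ hx)]
  have cg : p'' ∘ₗ g.restrictScalars K = g.restrictScalars K ∘ₗ p := by
    refine M.eq_of_eq_on_deg _ _ fun c x hx => ?_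
    by_cases hc : c = d
    · subst hc
      simp [hp2 x hx, hp2'' _ (h.g_deg _ _ hx)]
    · simp [hp3 c hc x hx, hp3'' c hc _ (h.g_deg _ _ hx)]
  have cf' : ∀ x, p (f x) = f (p' x) := fun x => LinearMap.congr_fun cf x
  have cg' : ∀ x, p'' (g x) = g (p x) := fun x => LinearMap.congr_fun cg x
  let F : M'.piece i d →ₗ[K] M.piece i d :=
    (f.restrictScalars K).restrict fun x hx => by
      rw [mem_piece] at hx ⊢
      refine ⟨h.f_deg _ _ hx.1, ?_⟩
      simp only [LinearMap.coe_restrictScalars]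
      rw [← map_smul, hx.2]
  let G : M.piece i d →ₗ[K] M''.piece i d :=
    (g.restrictScalars K).restrict fun x hx => by
      rw [mem_piece] at hx ⊢
      refine ⟨h.g_deg _ _ hx.1, ?_⟩
      simp only [LinearMap.coe_restrictScalars]
      rw [← map_smul, hx.2]
  have hF : Function.Injective F := fun x y hxy =>
    Subtype.ext (h.injective (congrArg Subtype.val hxy))
  have hG : Function.Surjective G := by
    rintro ⟨y, hy⟩
    rw [mem_piece] at hy
    obtain ⟨x, rfl⟩ := h.surjective y
    refine ⟨⟨R.e D K i • p x, ?_⟩, Subtype.ext ?_⟩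
    · exact ⟨p x, hp1 x, rfl⟩
    · change g (R.e D K i • p x) = g x
      rw [map_smul, ← cg', hp2'' _ hy.1, hy.2]
  have hFG : LinearMap.range F = LinearMap.ker G := by
    ext ⟨x, hx⟩
    have hx' := hx
    rw [mem_piece] at hx'
    simp only [LinearMap.mem_range, LinearMap.mem_ker]
    constructor
    · rintro ⟨⟨y, hy⟩, hxy⟩
      have e1 : f y = x := congrArg Subtype.val hxy
      exact Subtype.ext ((h.exact x).2 ⟨y, e1⟩)
    · intro hg
      have e1 : g x = 0 := congrArg Subtype.val hg
      obtain ⟨y, rfl⟩ := (h.exact x).1 e1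
      refine ⟨⟨y, (mem_piece _ _ _ _).2 ⟨?_, ?_⟩⟩, Subtype.ext rfl⟩
      · have : f y = f (p' y) := by rw [← cf', hp2 _ hx'.1]
        rw [h.injective this]
        exact hp1' y
      · apply h.injective
        rw [map_smul, hx'.2]
  rw [← LinearMap.finrank_range_add_finrank_ker G, ← hFG, LinearMap.range_eq_top.2 hG,
    LinearMap.finrank_range_of_inj hF, finrank_top, add_comm]

lemma finite_support (M : GrMod D K n ν) (i : SeqOf n ν) :
    (Function.support fun d : ℤ =>
      (Module.finrank K (M.piece i d) : ℤ[T;T⁻¹]) * LaurentPolynomial.T d).Finite := by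
  have h := WellFoundedGT.finite_ne_bot_of_iSupIndep M.isInternal.submodule_iSupIndep
  refine h.subset fun d hd => ?_
  contrapose! hd
  have hd' : M.deg d = ⊥ := not_not.1 hd
  have : Module.finrank K (M.piece i d) = 0 := by
    rw [piece, hd', Submodule.map_bot, finrank_bot]
  rw [Function.notMem_support, this, Nat.cast_zero, zero_mul]

lemma character_add {M' M M'' : GrMod D K n ν}
    {f : M'.carrier →ₗ[R D K n ν] M.carrier} {g : M.carrier →ₗ[R D K n ν] M''.carrier}
    (h : IsShortExact f g) : M.character = M'.character + M''.character := by
  have : ∀ i, M.gdim i = M'.gdim i + M''.gdim i := fun i => by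
    rw [gdim, gdim, gdim, ← finsum_add_distrib (M'.finite_support i) (M''.finite_support i)]
    simp [finrank_piece h, add_mul]
  simp [character, this, Finset.sum_add_distrib]

lemma character_shift (M : GrMod D K n ν) (m : ℤ) :
    (M.shift m).character = (LaurentPolynomial.T m : ℤ[T;T⁻¹]) • M.character := by
  have : ∀ i, (M.shift m).gdim i = LaurentPolynomial.T m * M.gdim i := fun i => by
    rw [gdim, gdim, mul_finsum' _ _ (M.finite_support i)]
    rw [← finsum_comp_equiv (Equiv.subRight m) (f := fun d => LaurentPolynomial.T m *
      ((Module.finrank K (M.piece i d) : ℤ[T;T⁻¹]) * LaurentPolynomial.T d))]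
    refine finsum_congr fun d => ?_
    change (Module.finrank K (M.piece i (d - m)) : ℤ[T;T⁻¹]) * LaurentPolynomial.T d =
      LaurentPolynomial.T m * ((Module.finrank K (M.piece i (d - m)) : ℤ[T;T⁻¹])
        * LaurentPolynomial.T (d - m))
    rw [mul_left_comm, ← LaurentPolynomial.T_add, add_sub_cancel]
  simp [character, this, Finset.smul_sum]

end GrMod

variable (D K n ν)

/-- The subgroup generated by `[M] - [M'] - [M'']` for short exact sequences
`0 → M' → M → M'' → 0` of finite-dimensional graded modules. -/
def exactRelations : AddSubgroup (FreeAbelianGroup (GrMod D K n ν)) :=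
  AddSubgroup.closure {z | ∃ (M' M M'' : GrMod D K n ν)
    (f : M'.carrier →ₗ[R D K n ν] M.carrier) (g : M.carrier →ₗ[R D K n ν] M''.carrier),
    GrMod.IsShortExact f g ∧ z = .of M - .of M' - .of M''}

/-- The Grothendieck group `G₀(R(ν))` of the category of finite-dimensional graded
`R(ν)`-modules. -/
def G0 : Type (max (u + 1) v) :=
  FreeAbelianGroup (GrMod D K n ν) ⧸ exactRelations D K n ν

noncomputable instance : AddCommGroup (G0 D K n ν) :=
  inferInstanceAs (AddCommGroup (_ ⧸ exactRelations D K n ν))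

variable {D K n ν}

namespace G0

/-- The class `[M]`. -/
def mk (M : GrMod D K n ν) : G0 D K n ν :=
  QuotientAddGroup.mk' (exactRelations D K n ν) (.of M)

/-- The additive map out of `G₀` given by an additive function on modules. -/
def lift {A : Type*} [AddCommGroup A] (φ : GrMod D K n ν → A)
    (hφ : ∀ (M' M M'' : GrMod D K n ν)
      (f : M'.carrier →ₗ[R D K n ν] M.carrier) (g : M.carrier →ₗ[R D K n ν] M''.carrier),
      GrMod.IsShortExact f g → φ M = φ M' + φ M'') : G0 D K n ν →+ A :=
  QuotientAddGroup.lift (exactRelations D K n ν) (FreeAbelianGroup.lift φ) (by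
    rw [exactRelations, AddSubgroup.closure_le]
    rintro _ ⟨M', M, M'', f, g, h, rfl⟩
    simp [hφ _ _ _ f g h, AddMonoidHom.mem_ker])

@[simp] lemma lift_mk {A : Type*} [AddCommGroup A] (φ : GrMod D K n ν → A) (hφ)
    (M : GrMod D K n ν) : lift φ hφ (mk M) = φ M :=
  FreeAbelianGroup.lift_apply_of _ _

@[ext] lemma hom_ext {A : Type*} [AddCommGroup A] {f g : G0 D K n ν →+ A}
    (h : ∀ M, f (mk M) = g (mk M)) : f = g :=
  QuotientAddGroup.addMonoidHom_ext _ (FreeAbelianGroup.lift_ext _ _ fun M => h M)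

lemma mk_add {M' M M'' : GrMod D K n ν}
    {f : M'.carrier →ₗ[R D K n ν] M.carrier} {g : M.carrier →ₗ[R D K n ν] M''.carrier}
    (h : GrMod.IsShortExact f g) : mk M = mk M' + mk M'' := by
  have : QuotientAddGroup.mk' (exactRelations D K n ν) (.of M - .of M' - .of M'') = 0 :=
    (QuotientAddGroup.eq_zero_iff _).2 (AddSubgroup.subset_closure ⟨M', M, M'', f, g, h, rfl⟩)
  rw [map_sub, map_sub, sub_sub, sub_eq_zero] at this
  exact this

/-- The endomorphism `[M] ↦ [M{m}]` of `G₀`. -/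
noncomputable def shiftHom (m : ℤ) : G0 D K n ν →+ G0 D K n ν :=
  lift (fun M => mk (M.shift m)) fun _ _ _ f g h =>
    mk_add (f := f) (g := g)
      ⟨fun _ x => h.f_deg _ x, fun _ x => h.g_deg _ x, h.injective, h.exact, h.surjective⟩

/-- The degree shifts as an action of the additive group of integers on `G₀`. -/
noncomputable def shiftAction : Multiplicative ℤ →* AddMonoid.End (G0 D K n ν) where
  toFun m := shiftHom m.toAdd
  map_one' := by
    apply hom_ext
    intro M
    change shiftHom 0 (mk M) = mk M
    simp [shiftHom, GrMod.shift_zero]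
  map_mul' a b := by
    apply hom_ext
    intro M
    change shiftHom (a.toAdd + b.toAdd) (mk M) = shiftHom a.toAdd (shiftHom b.toAdd (mk M))
    simp [shiftHom, GrMod.shift_shift, add_comm]

/-- The `ℤ[q,q⁻¹]`-module structure on `G₀` with `q [M] = [M{1}]`. -/
noncomputable instance : Module ℤ[T;T⁻¹] (G0 D K n ν) :=
  Module.compHom _ (AddMonoidAlgebra.lift ℤ (AddMonoid.End (G0 D K n ν)) ℤ shiftAction).toRingHom

lemma T_smul_mk (m : ℤ) (M : GrMod D K n ν) :
    (LaurentPolynomial.T m : ℤ[T;T⁻¹]) • mk M = mk (M.shift m) := by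
  change (AddMonoidAlgebra.lift ℤ (AddMonoid.End (G0 D K n ν)) ℤ shiftAction
    (AddMonoidAlgebra.single m 1)) (mk M) = _
  rw [AddMonoidAlgebra.lift_single, one_smul]
  change shiftHom m (mk M) = _
  simp [shiftHom]

end G0

/-- The character map `Ch : G₀(R(ν)) → ℤ[q,q⁻¹]Seq(ν)` as an additive map. -/
noncomputable def chAdd : G0 D K n ν →+ (SeqOf n ν →₀ ℤ[T;T⁻¹]) :=
  G0.lift GrMod.character fun _ _ _ _ _ h => GrMod.character_add h

lemma chAdd_T_smul (m : ℤ) (z : G0 D K n ν) :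
    chAdd ((LaurentPolynomial.T m : ℤ[T;T⁻¹]) • z)
      = (LaurentPolynomial.T m : ℤ[T;T⁻¹]) • chAdd z := by
  have : chAdd.comp (DistribSMul.toAddMonoidHom (G0 D K n ν) (LaurentPolynomial.T m : ℤ[T;T⁻¹]))
      = (DistribSMul.toAddMonoidHom _ (LaurentPolynomial.T m : ℤ[T;T⁻¹])).comp chAdd := by
    apply G0.hom_ext
    intro M
    simp [chAdd, G0.T_smul_mk, GrMod.character_shift]
  exact DFunLike.congr_fun this z

/-- The character map `Ch : G₀(R(ν)) → ℤ[q,q⁻¹]Seq(ν)`, `[M] ↦ Ch M`. -/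
noncomputable def Ch : G0 D K n ν →ₗ[ℤ[T;T⁻¹]] (SeqOf n ν →₀ ℤ[T;T⁻¹]) where
  toFun := chAdd
  map_add' := map_add _
  map_smul' p z := by
    simp only [RingHom.id_apply]
    induction p using LaurentPolynomial.induction_on' with
    | add p q hp hq => rw [add_smul, map_add, hp, hq, add_smul]
    | C_mul_T m a =>
      have hC : (LaurentPolynomial.C a : ℤ[T;T⁻¹]) = ((a : ℤ) : ℤ[T;T⁻¹]) := by simp
      rw [hC, ← smul_smul, ← smul_smul, Int.cast_smul_eq_zsmul, Int.cast_smul_eq_zsmul,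
        map_zsmul, chAdd_T_smul]

@[simp] lemma Ch_mk (M : GrMod D K n ν) : Ch (G0.mk M) = M.character :=
  G0.lift_mk GrMod.character (fun _ _ _ _ _ h => GrMod.character_add h) M

end Modules

end QuiverHecke

/-! An irreducible module can be recovered, up to shift, from a single word of its character.
Compare sequences lexicographically from the right, ranking at each position a letter equal to its
right neighbour above all others (`SeqOf.key`). The leading sequence `w` of `M` is the largest one
with 1_w M ≠ 0. If two irreducibles have the same leading sequence, they are isomorphic up to shift
(`GrMod.IsGrIrreducible.isIsoUpToShift`). So characters of inequivalent irreducibles have distinct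
leading words and are independent by triangularity (`GrMod.linearIndependent_character`).
Injectivity of `Ch` follows because classes of irreducibles span G₀.

To see that `w` determines `M`, note that the crossings inside the blocks of equal letters of `w`
satisfy the nilCoxeter relations. Hence 1_w M contains a nonzero homogeneous vector y killed by all
of them (`GrMod.exists_isSingular`). The core is that 1_w R y consists of polynomials in dots
applied to y (`IsExtremal.e_smul_smul_mem_dotSpan`). Modulo dots, crossings are sorted by inserting
one strand at a time. An insertion ending in `w` either exchanges equal letters of one block, or
needs a vector whose sequence is absent or larger than `w`, and such a vector is zero.

Dots have positive degree, so 1_w R y meets the degree of y only in the line K y. For irreducible M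
and N with singular vectors y and z of the same `w`, the core statement applied to (y, z) in M × N
shows that (0, z) is not in R (y, z). With irreducibility this forces Ann y = Ann z, and M ≅ R/Ann y
≅ N up to shift. -/

namespace QuiverHecke

/-! ### Words and rotations of a segment. -/

namespace SeqOf

variable {I : Type v} [DecidableEq I] {n : ℕ} {ν : I →₀ ℕ}

lemma swap_apply (k : ℕ) (hk : k + 1 < n) (i : SeqOf n ν) (p : Fin n) :
    (swap k hk i) p = i (Equiv.swap (⟨k, by omega⟩ : Fin n) ⟨k + 1, hk⟩ p) := rfl

lemma swap_left (k : ℕ) (hk : k + 1 < n) (i : SeqOf n ν) :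
    (swap k hk i) ⟨k, by omega⟩ = i ⟨k + 1, hk⟩ := by
  rw [swap_apply, Equiv.swap_apply_left]

lemma swap_right (k : ℕ) (hk : k + 1 < n) (i : SeqOf n ν) :
    (swap k hk i) ⟨k + 1, hk⟩ = i ⟨k, by omega⟩ := by
  rw [swap_apply, Equiv.swap_apply_right]

lemma swap_of_ne (k : ℕ) (hk : k + 1 < n) (i : SeqOf n ν) (p : Fin n) (h : p.1 ≠ k)
    (h' : p.1 ≠ k + 1) : (swap k hk i) p = i p := by
  rw [swap_apply, Equiv.swap_apply_of_ne_of_ne] <;> simpa [Fin.ext_iff]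

@[simp] lemma swap_swap (k : ℕ) (hk : k + 1 < n) (i : SeqOf n ν) :
    swap k hk (swap k hk i) = i :=
  Subtype.ext (funext fun p => by rw [swap_apply, swap_apply, Equiv.swap_apply_self])

lemma swap_eq_self (k : ℕ) (hk : k + 1 < n) (i : SeqOf n ν)
    (h : i ⟨k, by omega⟩ = i ⟨k + 1, hk⟩) : swap k hk i = i := by
  refine Subtype.ext (funext fun p => ?_)
  by_cases h1 : p.1 = k
  · obtain rfl : p = ⟨k, Nat.lt_of_succ_lt hk⟩ := Fin.ext h1
    exact (swap_left k hk i).trans h.symm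
  by_cases h2 : p.1 = k + 1
  · obtain rfl : p = ⟨k + 1, hk⟩ := Fin.ext h2
    exact (swap_right k hk i).trans h
  exact swap_of_ne k hk i p h1 h2

/-- The sequence obtained by moving the letter at position `a` to position `a + d`. -/
def rot (j : SeqOf n ν) (a : ℕ) : (d : ℕ) → a + d < n → SeqOf n ν
  | 0, _ => j
  | d + 1, h => rot (swap a (by omega) j) (a + 1) d (by omega)

/-- With the next three lemmas this describes `rot` everywhere: the segment [a, a + d] moves one
step to the left, and its first letter goes to the end. -/
lemma rot_of_lt (j : SeqOf n ν) (a d : ℕ) (h : a + d < n) (p : Fin n) (hp : p.1 < a) :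
    (j.rot a d h) p = j p := by
  induction d generalizing a j with
  | zero => rfl
  | succ d ih =>
    exact (ih _ (a + 1) (by omega) (by omega)).trans
      (swap_of_ne _ _ _ _ (by omega) (by omega))

lemma rot_of_gt (j : SeqOf n ν) (a d : ℕ) (h : a + d < n) (p : Fin n) (hp : a + d < p.1) :
    (j.rot a d h) p = j p := by
  induction d generalizing a j with
  | zero => rfl
  | succ d ih =>
    exact (ih _ (a + 1) (by omega) (by omega)).trans
      (swap_of_ne _ _ _ _ (by omega) (by omega))

lemma rot_last (j : SeqOf n ν) (a d : ℕ) (h : a + d < n) (p : Fin n) (hp : p.1 = a + d) :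
    (j.rot a d h) p = j ⟨a, by omega⟩ := by
  induction d generalizing a j with
  | zero => exact congrArg j.1 (Fin.ext hp)
  | succ d ih =>
    exact (ih _ (a + 1) (by omega) (by omega)).trans (swap_right _ _ _)

lemma rot_mid (j : SeqOf n ν) (a d : ℕ) (h : a + d < n) (p : ℕ) (hp : a ≤ p) (hp' : p < a + d) :
    (j.rot a d h) ⟨p, by omega⟩ = j ⟨p + 1, by omega⟩ := by
  induction d generalizing a j with
  | zero => omega
  | succ d ih =>
    rcases hp.eq_or_lt with rfl | hlt
    · exact (rot_of_lt _ (a + 1) d (by omega) _ (by simp)).trans (swap_left _ _ _)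
    · exact (ih _ (a + 1) (by omega) (by omega) (by omega)).trans
        (swap_of_ne _ _ _ _ (by simp; omega) (by simp; omega))

end SeqOf

/-! ### The defining relations, read in R(ν). -/

section Relations

variable {I : Type v} [DecidableEq I] [Fintype I] {D : BorcherdsCartanDatum I}
  {K : Type u} [Field K] {n : ℕ} {ν : I →₀ ℕ}

open SeqOf

namespace R

variable (D K) in
/-- The element `x_{k,i}` of `R(ν)`. -/
noncomputable def x (k : Fin n) (i : SeqOf n ν) : R D K n ν := gen D K (.x k i)

variable (D K) in
/-- The element `τ_{k,i}` of `R(ν)`. -/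
noncomputable def t (k : ℕ) (hk : k + 1 < n) (i : SeqOf n ν) : R D K n ν := gen D K (.t k hk i)

variable (D K n ν) in
/-- The projection from the free algebra on the generators onto `R(ν)`. -/
noncomputable def proj : FreeAlgebra K (Gen n ν) →ₐ[K] R D K n ν :=
  RingQuot.mkAlgHom K (Rel D K n ν)

lemma proj_surjective : Function.Surjective (proj D K n ν) :=
  RingQuot.mkAlgHom_surjective K _

lemma proj_rel {a b : FreeAlgebra K (Gen n ν)} (h : Rel D K n ν a b) :
    proj D K n ν a = proj D K n ν b := RingQuot.mkAlgHom_rel K h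

lemma proj_fe (i : SeqOf n ν) : proj D K n ν (fe K i) = e D K i := rfl

lemma proj_fx (k : Fin n) (i : SeqOf n ν) : proj D K n ν (fx K k i) = x D K k i := rfl

lemma proj_ft (k : ℕ) (hk : k + 1 < n) (i : SeqOf n ν) :
    proj D K n ν (ft K k hk i) = t D K k hk i := rfl

lemma e_mul_self (i : SeqOf n ν) : e D K i * e D K i = e D K i := by
  simpa only [map_mul, proj_fe, proj_fx, proj_ft] using
    proj_rel (Rel.e_mul_self (D := D) (K := K) i)

lemma e_mul_ne {i j : SeqOf n ν} (h : i ≠ j) : e D K i * e D K j = 0 := by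
  simpa only [map_mul, map_zero, proj_fe, proj_ft] using
    proj_rel (Rel.e_mul_ne (D := D) (K := K) i j h)

lemma sum_e : ∑ i, e D K i = (1 : R D K n ν) := by
  simpa only [map_sum, map_one, proj_fe] using
    proj_rel (Rel.sum_e (D := D) (K := K) (n := n) (ν := ν))

lemma e_mul_x (k : Fin n) (i : SeqOf n ν) : e D K i * x D K k i = x D K k i := by
  simpa only [map_mul, proj_fe, proj_fx, proj_ft] using proj_rel (Rel.e_mul_x (D := D) (K := K) k i)

lemma x_mul_e (k : Fin n) (i : SeqOf n ν) : x D K k i * e D K i = x D K k i := by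
  simpa only [map_mul, proj_fe, proj_fx, proj_ft] using proj_rel (Rel.x_mul_e (D := D) (K := K) k i)

lemma e_mul_t (k : ℕ) (hk : k + 1 < n) (i : SeqOf n ν) :
    e D K (swap k hk i) * t D K k hk i = t D K k hk i := by
  simpa only [map_mul, proj_fe, proj_fx, proj_ft] using
    proj_rel (Rel.e_mul_t (D := D) (K := K) k hk i)

lemma t_mul_e (k : ℕ) (hk : k + 1 < n) (i : SeqOf n ν) :
    t D K k hk i * e D K i = t D K k hk i := by
  simpa only [map_mul, proj_fe, proj_fx, proj_ft] using
    proj_rel (Rel.t_mul_e (D := D) (K := K) k hk i)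

lemma x_mul_e_ne (k : Fin n) {i j : SeqOf n ν} (h : i ≠ j) : x D K k i * e D K j = 0 := by
  rw [← x_mul_e, mul_assoc, e_mul_ne h, mul_zero]

lemma t_mul_e_ne (k : ℕ) (hk : k + 1 < n) {i j : SeqOf n ν} (h : i ≠ j) :
    t D K k hk i * e D K j = 0 := by
  rw [← t_mul_e, mul_assoc, e_mul_ne h, mul_zero]

lemma e_mul_t_ne (k : ℕ) (hk : k + 1 < n) {i j : SeqOf n ν} (h : j ≠ swap k hk i) :
    e D K j * t D K k hk i = 0 := by
  rw [← e_mul_t, ← mul_assoc, e_mul_ne h, zero_mul]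

lemma x_mul_t_ne (p : Fin n) (k : ℕ) (hk : k + 1 < n) {i j : SeqOf n ν} (h : j ≠ swap k hk i) :
    x D K p j * t D K k hk i = 0 := by
  rw [← e_mul_t, ← mul_assoc, x_mul_e_ne _ h, zero_mul]

lemma t_mul_t_ne (l : ℕ) (hl : l + 1 < n) (k : ℕ) (hk : k + 1 < n) {i j : SeqOf n ν}
    (h : j ≠ swap k hk i) : t D K l hl j * t D K k hk i = 0 := by
  rw [← e_mul_t k, ← mul_assoc, t_mul_e_ne _ _ h, zero_mul]

lemma t_mul_t_far (k l : ℕ) (hk : k + 1 < n) (hl : l + 1 < n) (hkl : k + 1 < l ∨ l + 1 < k)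
    (i : SeqOf n ν) :
    t D K k hk (swap l hl i) * t D K l hl i = t D K l hl (swap k hk i) * t D K k hk i := by
  rcases hkl with h | h
  · simpa only [map_mul, proj_fe, proj_fx, proj_ft] using
      proj_rel (Rel.t_t_far (D := D) (K := K) k l hk hl h i)
  · simpa only [map_mul, proj_fe, proj_fx, proj_ft] using
      (proj_rel (Rel.t_t_far (D := D) (K := K) l k hl hk h i)).symm

/-- Moving a dot downwards through a crossing, up to a multiple of an idempotent. -/
lemma exists_x_mul_t (p : Fin n) (k : ℕ) (hk : k + 1 < n) (i : SeqOf n ν) :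
    ∃ (q : Fin n) (c : K), x D K p (swap k hk i) * t D K k hk i =
      t D K k hk i * x D K q i + c • e D K i := by
  by_cases h1 : p.1 = k
  · obtain rfl : p = ⟨k, Nat.lt_of_succ_lt hk⟩ := Fin.ext h1
    by_cases h : i ⟨k, by omega⟩ = i ⟨k + 1, hk⟩
    · rcases D.diag (i ⟨k, by omega⟩) with hr | hi
      · refine ⟨⟨k + 1, hk⟩, 1, ?_⟩
        have := proj_rel (Rel.x_t_real (D := D) (K := K) k hk i h hr)
        simp only [map_mul, map_sub, proj_fx, proj_ft, proj_fe] at this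
        rw [one_smul, ← this]; abel
      · refine ⟨⟨k + 1, hk⟩, 0, ?_⟩
        simpa only [map_mul, proj_fx, proj_ft, zero_smul, add_zero] using
          proj_rel (Rel.x_t_imag (D := D) (K := K) k hk i h hi.1)
    · refine ⟨⟨k + 1, hk⟩, 0, ?_⟩
      simpa only [map_mul, proj_fx, proj_ft, zero_smul, add_zero] using
        proj_rel (Rel.x_t_ne (D := D) (K := K) k hk i h)
  by_cases h2 : p.1 = k + 1
  · obtain rfl : p = ⟨k + 1, hk⟩ := Fin.ext h2
    by_cases h : i ⟨k, by omega⟩ = i ⟨k + 1, hk⟩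
    · rcases D.diag (i ⟨k, by omega⟩) with hr | hi
      · refine ⟨⟨k, by omega⟩, -1, ?_⟩
        have := proj_rel (Rel.t_x_real (D := D) (K := K) k hk i h hr)
        simp only [map_mul, map_sub, proj_fx, proj_ft, proj_fe] at this
        rw [neg_smul, one_smul, ← this]; abel
      · refine ⟨⟨k, by omega⟩, 0, ?_⟩
        simpa only [map_mul, proj_fx, proj_ft, zero_smul, add_zero] using
          (proj_rel (Rel.t_x_imag (D := D) (K := K) k hk i h hi.1)).symm
    · refine ⟨⟨k, by omega⟩, 0, ?_⟩
      simpa only [map_mul, proj_fx, proj_ft, zero_smul, add_zero] using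
        (proj_rel (Rel.t_x_ne (D := D) (K := K) k hk i h)).symm
  · refine ⟨p, 0, ?_⟩
    simpa only [map_mul, proj_fx, proj_ft, zero_smul, add_zero] using
      proj_rel (Rel.x_t_far (D := D) (K := K) k hk p h1 h2 i)

/-- Moving a dot upwards through a crossing, up to a multiple of an idempotent. -/
lemma exists_t_mul_x (p : Fin n) (k : ℕ) (hk : k + 1 < n) (i : SeqOf n ν) :
    ∃ (q : Fin n) (c : K), t D K k hk i * x D K p i =
      x D K q (swap k hk i) * t D K k hk i + c • e D K i := by
  by_cases h1 : p.1 = k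
  · obtain rfl : p = ⟨k, Nat.lt_of_succ_lt hk⟩ := Fin.ext h1
    by_cases h : i ⟨k, by omega⟩ = i ⟨k + 1, hk⟩
    · rcases D.diag (i ⟨k, by omega⟩) with hr | hi
      · refine ⟨⟨k + 1, hk⟩, 1, ?_⟩
        have := proj_rel (Rel.t_x_real (D := D) (K := K) k hk i h hr)
        simp only [map_mul, map_sub, proj_fx, proj_ft, proj_fe] at this
        rw [one_smul, ← this]; abel
      · refine ⟨⟨k + 1, hk⟩, 0, ?_⟩
        simpa only [map_mul, proj_fx, proj_ft, zero_smul, add_zero] using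
          proj_rel (Rel.t_x_imag (D := D) (K := K) k hk i h hi.1)
    · refine ⟨⟨k + 1, hk⟩, 0, ?_⟩
      simpa only [map_mul, proj_fx, proj_ft, zero_smul, add_zero] using
        proj_rel (Rel.t_x_ne (D := D) (K := K) k hk i h)
  by_cases h2 : p.1 = k + 1
  · obtain rfl : p = ⟨k + 1, hk⟩ := Fin.ext h2
    by_cases h : i ⟨k, by omega⟩ = i ⟨k + 1, hk⟩
    · rcases D.diag (i ⟨k, by omega⟩) with hr | hi
      · refine ⟨⟨k, by omega⟩, -1, ?_⟩
        have := proj_rel (Rel.x_t_real (D := D) (K := K) k hk i h hr)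
        simp only [map_mul, map_sub, proj_fx, proj_ft, proj_fe] at this
        rw [neg_smul, one_smul, ← this]; abel
      · refine ⟨⟨k, by omega⟩, 0, ?_⟩
        simpa only [map_mul, proj_fx, proj_ft, zero_smul, add_zero] using
          (proj_rel (Rel.x_t_imag (D := D) (K := K) k hk i h hi.1)).symm
    · refine ⟨⟨k, by omega⟩, 0, ?_⟩
      simpa only [map_mul, proj_fx, proj_ft, zero_smul, add_zero] using
        (proj_rel (Rel.x_t_ne (D := D) (K := K) k hk i h)).symm
  · refine ⟨p, 0, ?_⟩
    simpa only [map_mul, proj_fx, proj_ft, zero_smul, add_zero] using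
      (proj_rel (Rel.x_t_far (D := D) (K := K) k hk p h1 h2 i)).symm

lemma t_mul_t_same (k : ℕ) (hk : k + 1 < n) (i : SeqOf n ν)
    (h : i ⟨k, by omega⟩ = i ⟨k + 1, hk⟩) : t D K k hk (swap k hk i) * t D K k hk i = 0 := by
  simpa only [map_mul, map_zero, proj_fe, proj_ft] using
    proj_rel (Rel.t_sq_same (D := D) (K := K) k hk i h)

/-- The correction term of the braid relation requires different letters at `k` and `k + 1`. Inside
a block of equal letters the braid relation is therefore exact, which together with `t_mul_t_same`
yields nilCoxeter operators. -/
lemma braid_of_eq (k : ℕ) (hk : k + 2 < n) (i : SeqOf n ν)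
    (h : i ⟨k, by omega⟩ = i ⟨k + 1, by omega⟩) :
    t D K k (by omega) (swap (k + 1) hk (swap k (by omega) i))
        * t D K (k + 1) hk (swap k (by omega) i) * t D K k (by omega) i =
      t D K (k + 1) hk (swap k (by omega) (swap (k + 1) hk i))
        * t D K k (by omega) (swap (k + 1) hk i) * t D K (k + 1) hk i := by
  simpa only [map_mul, proj_fe, proj_fx, proj_ft] using
    proj_rel (Rel.braid (D := D) (K := K) k hk i (fun h' => h'.2.2.1 h))

end R

end Relations

end QuiverHecke

namespace QuiverHecke

/-! ### Subspaces stable under dots and crossings, and insertion of one strand. -/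

section Shuffle

open SeqOf

variable {I : Type v} [DecidableEq I] [Fintype I] {D : BorcherdsCartanDatum I}
  {K : Type u} [Field K] {n : ℕ} {ν : I →₀ ℕ}
  {X : Type*} [AddCommGroup X] [Module K X] [Module (R D K n ν) X]

variable (D) in
/-- A subspace stable under all idempotents and all dots. -/
structure IsDotStable (V : Submodule K X) : Prop where
  e_smul_mem : ∀ i, ∀ y ∈ V, R.e D K (n := n) (ν := ν) i • y ∈ V
  x_smul_mem : ∀ p i, ∀ y ∈ V, R.x D K (n := n) (ν := ν) p i • y ∈ V

lemma IsDotStable.pow_smul_mem {V : Submodule K X} (hV : IsDotStable D (n := n) (ν := ν) V)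
    (p : Fin n) (i : SeqOf n ν) (c : ℕ) {y : X} (hy : y ∈ V) : R.x D K p i ^ c • y ∈ V := by
  induction c with
  | zero => simpa using hy
  | succ c ih => rw [pow_succ', mul_smul]; exact hV.x_smul_mem _ _ _ ih

/-- A double crossing is zero, an idempotent or a polynomial in dots; if `j` is not `s_k i`, the
product vanishes. -/
lemma IsDotStable.t_t_smul_mem {V : Submodule K X} (hV : IsDotStable D (n := n) (ν := ν) V)
    {k : ℕ} (hk : k + 1 < n) (i j : SeqOf n ν) {y : X} (hy : y ∈ V) :
    R.t D K k hk j • R.t D K k hk i • y ∈ V := by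
  rw [smul_smul]
  by_cases hj : j = swap k hk i
  · subst hj
    by_cases h : i ⟨k, by omega⟩ = i ⟨k + 1, hk⟩
    · rw [R.t_mul_t_same k hk i h, zero_smul]
      exact V.zero_mem
    · by_cases h0 : D.dot (i ⟨k, by omega⟩) (i ⟨k + 1, hk⟩) = 0
      · have := R.proj_rel (Rel.t_sq_orth (D := D) (K := K) k hk i h h0)
        simp only [map_mul, R.proj_ft, R.proj_fe] at this
        rw [this]
        exact hV.e_smul_mem _ _ hy
      · have := R.proj_rel (Rel.t_sq_adj (D := D) (K := K) k hk i h h0)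
        simp only [map_mul, map_add, map_pow, R.proj_ft, R.proj_fe, R.proj_fx] at this
        rw [this, mul_smul, add_smul]
        have := hV.e_smul_mem i _ hy
        exact V.add_mem (hV.pow_smul_mem _ _ _ this) (hV.pow_smul_mem _ _ _ this)
  · rw [R.t_mul_t_ne _ _ _ _ hj, zero_smul]
    exact V.zero_mem

/-- The correction term is a polynomial in dots, so on vectors of a dot-stable subspace the braid
relation holds modulo that subspace. -/
lemma IsDotStable.braid_smul_mem {V : Submodule K X} (hV : IsDotStable D (n := n) (ν := ν) V)
    {k : ℕ} (hk : k + 2 < n) (i : SeqOf n ν) {y : X} (hy : y ∈ V) :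
    (R.t D K k (by omega) (swap (k + 1) hk (swap k (by omega) i))
        * R.t D K (k + 1) hk (swap k (by omega) i) * R.t D K k (by omega) i -
      R.t D K (k + 1) hk (swap k (by omega) (swap (k + 1) hk i))
        * R.t D K k (by omega) (swap (k + 1) hk i) * R.t D K (k + 1) hk i) • y ∈ V := by
  by_cases h : i ⟨k, by omega⟩ = i ⟨k + 2, hk⟩ ∧ D.IsReal (i ⟨k, by omega⟩) ∧
        i ⟨k, by omega⟩ ≠ i ⟨k + 1, by omega⟩ ∧
        D.dot (i ⟨k, by omega⟩) (i ⟨k + 1, by omega⟩) ≠ 0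
  · have := R.proj_rel (Rel.braid_special (D := D) (K := K) k hk i h.1 h.2.1 h.2.2.1 h.2.2.2)
    simp only [map_mul, map_sub, map_sum, map_pow, R.proj_ft, R.proj_fe, R.proj_fx] at this
    rw [this, Finset.sum_smul]
    refine V.sum_mem fun c _ => ?_
    rw [mul_smul, mul_smul]
    exact hV.pow_smul_mem _ _ _ (hV.pow_smul_mem _ _ _ (hV.e_smul_mem _ _ hy))
  · have := R.proj_rel (Rel.braid (D := D) (K := K) k hk i h)
    simp only [map_mul, R.proj_ft] at this
    rw [this, sub_self, zero_smul]
    exact V.zero_mem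

variable (D n ν) in
/-- A subspace stable under the crossings of the strands `k`, `k + 1`. -/
def IsCrossStable (k : ℕ) (V : Submodule K X) : Prop :=
  ∀ (hk : k + 1 < n) (i : SeqOf n ν), ∀ y ∈ V, R.t D K k hk i • y ∈ V

variable [IsScalarTower K (R D K n ν) X]

variable (D n ν) in
/-- The subspace spanned by the images of `V` under the crossings of the strands `k`, `k + 1`. -/
noncomputable def crossSpan (k : ℕ) (V : Submodule K X) : Submodule K X :=
  ⨆ (hk : k + 1 < n) (i : SeqOf n ν), V.map (Algebra.lsmul K K X (R.t D K k hk i))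

lemma t_smul_mem_crossSpan {k : ℕ} (hk : k + 1 < n) (i : SeqOf n ν) {V : Submodule K X} {y : X}
    (hy : y ∈ V) : R.t D K k hk i • y ∈ crossSpan D n ν k V :=
  Submodule.mem_iSup_of_mem hk (Submodule.mem_iSup_of_mem i ⟨y, hy, rfl⟩)

lemma crossSpan_le {k : ℕ} {V P : Submodule K X}
    (h : ∀ (hk : k + 1 < n) (i : SeqOf n ν), ∀ y ∈ V, R.t D K k hk i • y ∈ P) :
    crossSpan D n ν k V ≤ P := by
  refine iSup_le fun hk => iSup_le fun i => ?_
  rintro _ ⟨y, hy, rfl⟩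
  exact h hk i y hy

/-- To check that an element of `R(ν)` maps `V ⊔ crossSpan k V` into `P`. -/
lemma smul_mem_of_mem_sup {k : ℕ} {V P : Submodule K X} (r : R D K n ν)
    (h : ∀ y ∈ V, r • y ∈ P)
    (h' : ∀ (hk : k + 1 < n) (i : SeqOf n ν), ∀ y ∈ V, r • R.t D K k hk i • y ∈ P) {y : X}
    (hy : y ∈ V ⊔ crossSpan D n ν k V) : r • y ∈ P := by
  have : V ⊔ crossSpan D n ν k V ≤ P.comap (Algebra.lsmul K K X r) :=
    sup_le h (crossSpan_le h')
  exact this hy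

lemma smul_mem_of_mem_crossSpan {k : ℕ} {V P : Submodule K X} (r : R D K n ν)
    (h' : ∀ (hk : k + 1 < n) (i : SeqOf n ν), ∀ y ∈ V, r • R.t D K k hk i • y ∈ P) {y : X}
    (hy : y ∈ crossSpan D n ν k V) : r • y ∈ P := by
  have : crossSpan D n ν k V ≤ P.comap (Algebra.lsmul K K X r) := crossSpan_le h'
  exact this hy

/-- A dot slides down through a crossing up to a multiple of an idempotent, and this error lands in
`V`. -/
lemma IsDotStable.sup_crossSpan {V : Submodule K X} (hV : IsDotStable D (n := n) (ν := ν) V)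
    (k : ℕ) : IsDotStable D (n := n) (ν := ν) (V ⊔ crossSpan D n ν k V) where
  e_smul_mem j y hy := by
    refine smul_mem_of_mem_sup _ (fun y hy => Submodule.mem_sup_left (hV.e_smul_mem _ _ hy))
      (fun hk i y hy => ?_) hy
    rw [smul_smul]
    by_cases hj : j = swap k hk i
    · rw [hj, R.e_mul_t]
      exact Submodule.mem_sup_right (t_smul_mem_crossSpan hk i hy)
    · rw [R.e_mul_t_ne _ _ hj, zero_smul]
      exact Submodule.zero_mem _
  x_smul_mem p j y hy := by
    refine smul_mem_of_mem_sup _ (fun y hy => Submodule.mem_sup_left (hV.x_smul_mem _ _ _ hy))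
      (fun hk i y hy => ?_) hy
    rw [smul_smul]
    by_cases hj : j = swap k hk i
    · obtain ⟨q, c, h⟩ := R.exists_x_mul_t (D := D) (K := K) p k hk i
      rw [hj, h, add_smul, mul_smul, smul_assoc]
      exact Submodule.add_mem _
        (Submodule.mem_sup_right (t_smul_mem_crossSpan hk i (hV.x_smul_mem _ _ _ hy)))
        (Submodule.mem_sup_left (V.smul_mem _ (hV.e_smul_mem _ _ hy)))
    · rw [R.x_mul_t_ne _ _ _ hj, zero_smul]
      exact Submodule.zero_mem _

lemma IsCrossStable.sup_crossSpan {V : Submodule K X} {k l : ℕ}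
    (hV : IsCrossStable D n ν l V) (h : k + 1 < l ∨ l + 1 < k) :
    IsCrossStable D n ν l (V ⊔ crossSpan D n ν k V) := by
  intro hl j y hy
  refine smul_mem_of_mem_sup _ (fun y hy => Submodule.mem_sup_left (hV _ _ _ hy))
    (fun hk i y hy => ?_) hy
  rw [smul_smul]
  by_cases hj : j = swap k hk i
  · rw [hj, R.t_mul_t_far l k hl hk h.symm, mul_smul]
    exact Submodule.mem_sup_right (t_smul_mem_crossSpan hk _ (hV _ _ _ hy))
  · rw [R.t_mul_t_ne _ _ _ _ hj, zero_smul]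
    exact Submodule.zero_mem _

lemma IsDotStable.isCrossStable_sup {V : Submodule K X}
    (hV : IsDotStable D (n := n) (ν := ν) V) (k : ℕ) :
    IsCrossStable D n ν k (V ⊔ crossSpan D n ν k V) := by
  intro hk j y hy
  exact smul_mem_of_mem_sup _
    (fun y hy => Submodule.mem_sup_right (t_smul_mem_crossSpan hk _ hy))
    (fun hk i y hy => Submodule.mem_sup_left (hV.t_t_smul_mem hk i j hy)) hy

/-- The critical case: τ_{k+1} τ_k τ_{k+1} y equals τ_k τ_{k+1} τ_k y modulo `V`, and τ_k y stays in
`V` by hypothesis. -/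
lemma IsDotStable.isCrossStable_sup_sup {V : Submodule K X}
    (hV : IsDotStable D (n := n) (ν := ν) V) (k : ℕ) (hk : IsCrossStable D n ν k V) :
    IsCrossStable D n ν (k + 1) (V ⊔ crossSpan D n ν (k + 1) V ⊔
      crossSpan D n ν k (V ⊔ crossSpan D n ν (k + 1) V)) := by
  intro hk2 j y hy
  refine smul_mem_of_mem_sup _
    (fun y hy => Submodule.mem_sup_left (hV.isCrossStable_sup (k + 1) hk2 j y hy))
    (fun hk1 i y hy => ?_) hy
  rw [smul_smul]
  refine smul_mem_of_mem_sup _ (fun y hy => ?_) (fun hk' l y hy => ?_) hy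
  · rw [mul_smul]
    exact Submodule.mem_sup_left
      (Submodule.mem_sup_right (t_smul_mem_crossSpan hk2 _ (hk _ _ _ hy)))
  · rw [smul_smul]
    by_cases hi : i = swap (k + 1) hk2 l
    · by_cases hj : j = swap k hk1 i
      · have h := hV.braid_smul_mem hk2 l hy
        rw [← hi, ← hj, sub_smul] at h
        have hA := t_smul_mem_crossSpan (D := D) (ν := ν) hk1
          (swap (k + 1) hk2 (swap k hk1 l)) (V := V ⊔ crossSpan D n ν (k + 1) V)
          (Submodule.mem_sup_right (t_smul_mem_crossSpan hk2 (swap k hk1 l) (hk hk1 l y hy)))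
        rw [smul_smul, smul_smul] at hA
        have hS := Submodule.sub_mem (V ⊔ crossSpan D n ν (k + 1) V ⊔
          crossSpan D n ν k (V ⊔ crossSpan D n ν (k + 1) V)) (Submodule.mem_sup_right hA)
          (Submodule.mem_sup_left (Submodule.mem_sup_left h))
        rwa [sub_sub_cancel] at hS
      · rw [R.t_mul_t_ne _ _ _ _ hj, zero_mul, zero_smul]
        exact Submodule.zero_mem _
    · rw [mul_assoc, R.t_mul_t_ne _ _ _ _ hi, mul_zero, zero_smul]
      exact Submodule.zero_mem _

variable (D n ν) in
/-- The subspace of all vectors obtained from `U` by letting the strand at position `a + d` cross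
at most the strands at positions `a, …, a + d - 1`. -/
noncomputable def shuffleSpan (U : Submodule K X) : ℕ → ℕ → Submodule K X
  | _, 0 => U
  | a, d + 1 => shuffleSpan U (a + 1) d ⊔ crossSpan D n ν a (shuffleSpan U (a + 1) d)

variable (D n ν) in
/-- The subspace of all vectors obtained from `U` by letting the strand at position `a + d` cross
exactly the strands at positions `a, …, a + d - 1`. -/
noncomputable def strandSpan (U : Submodule K X) : ℕ → ℕ → Submodule K X
  | _, 0 => U
  | a, d + 1 => crossSpan D n ν a (strandSpan U (a + 1) d)

section

variable {U : Submodule K X} {a d : ℕ}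

lemma le_shuffleSpan : U ≤ shuffleSpan D n ν U a d := by
  induction d generalizing a with
  | zero => exact le_rfl
  | succ d ih => exact ih.trans le_sup_left

lemma IsDotStable.shuffleSpan (hU : IsDotStable D (n := n) (ν := ν) U) :
    IsDotStable D (n := n) (ν := ν) (shuffleSpan D n ν U a d) := by
  induction d generalizing a with
  | zero => exact hU
  | succ d ih => exact ih.sup_crossSpan a

lemma isCrossStable_shuffleSpan_of_lt {k : ℕ} (hU : IsCrossStable D n ν k U) (hk : k + 1 < a) :
    IsCrossStable D n ν k (shuffleSpan D n ν U a d) := by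
  induction d generalizing a with
  | zero => exact hU
  | succ d ih => exact (ih (by omega)).sup_crossSpan (Or.inr hk)

/-- The insertions are coset representatives for adding one strand. The crossing τ_k is absorbed by
the quadratic relation if k = a, by the braid relation if k = a + 1, and by far commutation and
descent to `a + 1` otherwise. -/
lemma isCrossStable_shuffleSpan_of_le {k : ℕ} (hU : IsDotStable D (n := n) (ν := ν) U)
    (hU' : ∀ l, l + 1 < a + d → IsCrossStable D n ν l U) (hk : a ≤ k) (hk' : k < a + d) :
    IsCrossStable D n ν k (shuffleSpan D n ν U a d) := by
  induction d generalizing a with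
  | zero => omega
  | succ d ih =>
    rcases hk.eq_or_lt with rfl | hlt
    · exact hU.shuffleSpan.isCrossStable_sup _
    rcases Nat.eq_or_lt_of_le hlt with rfl | hlt
    · cases d with
      | zero => omega
      | succ d =>
        exact hU.shuffleSpan.isCrossStable_sup_sup a
          (isCrossStable_shuffleSpan_of_lt (hU' a (by omega)) (by omega))
    · refine IsCrossStable.sup_crossSpan (ih ?_ (by omega) (by omega)) (Or.inl hlt)
      intro l hl
      exact hU' l (by omega)

/-- Separates the full insertion τ_a ⋯ τ_{a+d} from the shorter ones: if the strand stops at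
position a + 2 or later, τ_a commutes past the insertion and is absorbed by `U`. -/
lemma shuffleSpan_succ_le (hU' : ∀ l, l + 1 < a + d + 1 → IsCrossStable D n ν l U) :
    shuffleSpan D n ν U a (d + 1) ≤
      shuffleSpan D n ν U (a + 1) d ⊔ strandSpan D n ν U a (d + 1) := by
  induction d generalizing a with
  | zero => exact le_rfl
  | succ d ih =>
    refine sup_le le_sup_left (crossSpan_le fun hk i y hy => ?_)
    have hy' := ih (a := a + 1) (fun l hl => hU' l (by omega)) hy
    obtain ⟨y₁, h₁, y₂, h₂, rfl⟩ := Submodule.mem_sup.1 hy'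
    rw [smul_add]
    refine Submodule.add_mem _ ?_ ?_
    · refine Submodule.mem_sup_left (Submodule.mem_sup_left ?_)
      exact isCrossStable_shuffleSpan_of_lt (hU' a (by omega)) (by omega) hk i _ h₁
    · exact Submodule.mem_sup_right (t_smul_mem_crossSpan hk i h₂)

/-- The idempotent of a sequence kills a shuffle if it kills the sequence before the shuffle. -/
lemma e_smul_eq_zero_of_mem_strandSpan (j : SeqOf n ν) (h : a + d < n)
    (hU : ∀ u ∈ U, R.e D K (j.rot a d h) • u = 0) {y : X}
    (hy : y ∈ strandSpan D n ν U a d) : R.e D K j • y = 0 := by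
  induction d generalizing a j y with
  | zero => exact hU y hy
  | succ d ih =>
    rw [← Submodule.mem_bot K]
    refine smul_mem_of_mem_crossSpan _ (fun hk i y hy => ?_) hy
    rw [Submodule.mem_bot, smul_smul]
    by_cases hj : j = swap a hk i
    · rw [hj, R.e_mul_t, ← R.t_mul_e, mul_smul, ih i (by omega) _ hy, smul_zero]
      intro u hu
      have := hU u hu
      rw [rot, hj, swap_swap] at this
      exact this
    · rw [R.e_mul_t_ne _ _ hj, zero_smul]

/-- As `w` is constant on [a, a + d], every crossing used that ends in `w` also starts in `w`, so
`hW` applies to one crossing after another. -/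
lemma e_smul_mem_of_mem_strandSpan (w : SeqOf n ν) (h : a + d < n) {W : Submodule K X}
    (hW : ∀ (k : ℕ) (hk : k + 1 < n), w ⟨k, by omega⟩ = w ⟨k + 1, hk⟩ →
      ∀ y ∈ W, R.t D K k hk w • y ∈ W)
    (hw : ∀ k (_ : a ≤ k) (_ : k < a + d), w ⟨k, by omega⟩ = w ⟨k + 1, by omega⟩)
    (hU : ∀ u ∈ U, R.e D K w • u ∈ W) {y : X}
    (hy : y ∈ strandSpan D n ν U a d) : R.e D K w • y ∈ W := by
  induction d generalizing a y with
  | zero => exact hU y hy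
  | succ d ih =>
    refine smul_mem_of_mem_crossSpan _ (fun hk i y hy => ?_) hy
    rw [smul_smul]
    have hs := swap_eq_self a hk w (hw a le_rfl (by omega))
    by_cases hj : w = swap a hk i
    · obtain rfl : w = i := by rw [← hs, hj, swap_swap]
      have ht := R.e_mul_t (D := D) (K := K) a hk w
      rw [hs] at ht
      rw [ht, ← R.t_mul_e, mul_smul]
      refine hW a hk (hw a le_rfl (by omega)) _ (ih (by omega) hW (fun k h1 h2 => ?_) hy)
      exact hw k (by omega) (by omega)
    · rw [R.e_mul_t_ne _ _ hj, zero_smul]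
      exact W.zero_mem

lemma e_smul_eq_zero_of_mem_shuffleSpan (w : SeqOf n ν) (t : ℕ) (ht : a + d ≤ t)
    (hU : ∀ u ∈ U, ∀ j : SeqOf n ν, (∃ q : Fin n, t < q.1 ∧ j q ≠ w q) → R.e D K j • u = 0)
    {y : X} (hy : y ∈ shuffleSpan D n ν U a d) (j : SeqOf n ν)
    (hj : ∃ q : Fin n, t < q.1 ∧ j q ≠ w q) : R.e D K j • y = 0 := by
  induction d generalizing a j y with
  | zero => exact hU y hy j hj
  | succ d ih =>
    rw [← Submodule.mem_bot K]
    refine smul_mem_of_mem_sup _ (fun y hy => ?_) (fun hk i y hy => ?_) hy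
    · rw [Submodule.mem_bot]
      exact ih (by omega) hy j hj
    · rw [Submodule.mem_bot, smul_smul]
      by_cases h : j = swap a hk i
      · rw [h, R.e_mul_t, ← R.t_mul_e, mul_smul, ih (by omega) hy, smul_zero]
        obtain ⟨q, hq, hne⟩ := hj
        refine ⟨q, hq, ?_⟩
        rwa [h, swap_of_ne _ _ _ _ (by omega) (by omega)] at hne
      · rw [R.e_mul_t_ne _ _ h, zero_smul]

end

/-! ### Extremal sequences and the vectors they generate. -/

variable (D K X) in
/-- Every sequence that dominates `w` acts as zero on `X`: it agrees with `w` beyond some position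
`p`, and at `p` it continues the block of equal letters at `p + 1`, whereas `w` does not. -/
def IsExtremal (w : SeqOf n ν) : Prop :=
  ∀ (j : SeqOf n ν) (p : ℕ) (hp : p + 1 < n), (∀ q : Fin n, p < q.1 → j q = w q) →
    j ⟨p, by omega⟩ = j ⟨p + 1, hp⟩ → w ⟨p, by omega⟩ ≠ j ⟨p, by omega⟩ →
    ∀ y : X, R.e D K j • y = 0

/-- Pulled down through τ_a ⋯ τ_{a+d-1}, the idempotent of `w` becomes that of `w.rot a d`. If `w`
is constant on the segment, only block crossings occur. If its end letters differ, the rotated word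
differs from `w` at a + d and is absent from `U`. Otherwise the rotated word dominates `w`, and
extremality kills it. -/
lemma IsExtremal.e_smul_mem_of_mem_strandSpan {w : SeqOf n ν} (hw : IsExtremal D K X w)
    {U W : Submodule K X}
    (hW : ∀ (k : ℕ) (hk : k + 1 < n), w ⟨k, by omega⟩ = w ⟨k + 1, hk⟩ →
      ∀ y ∈ W, R.t D K k hk w • y ∈ W)
    {a d : ℕ} (h : a + d < n)
    (hU : ∀ u ∈ U, ∀ j : SeqOf n ν, (∃ q : Fin n, a + d ≤ q.1 ∧ j q ≠ w q) → R.e D K j • u = 0)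
    (hUW : ∀ u ∈ U, R.e D K w • u ∈ W) {y : X}
    (hy : y ∈ strandSpan D n ν U a d) : R.e D K w • y ∈ W := by
  by_cases hc : ∀ k (_ : a ≤ k) (_ : k < a + d), w ⟨k, by omega⟩ = w ⟨k + 1, by omega⟩
  · exact QuiverHecke.e_smul_mem_of_mem_strandSpan w h hW hc hUW hy
  rw [QuiverHecke.e_smul_eq_zero_of_mem_strandSpan w h _ hy]
  · exact W.zero_mem
  intro u hu
  by_cases hlast : w ⟨a, by omega⟩ = w ⟨a + d, h⟩
  · -- the last position `p` at which the letters of `w` on `[a, a + d]` change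
    obtain ⟨p, ⟨hp1, hp2, hp3⟩, hmax⟩ : ∃ p, (∃ (_ : a ≤ p) (_ : p < a + d),
        w ⟨p, by omega⟩ ≠ w ⟨p + 1, by omega⟩) ∧ ∀ q, p < q → ∀ (hq : q < a + d),
        w ⟨q, by omega⟩ = w ⟨q + 1, by omega⟩ := by
      classical
      push Not at hc
      obtain ⟨k, h1, h2, h3⟩ := hc
      have hP : ∃ m ≤ a + d, ∃ (_ : a ≤ m) (_ : m < a + d),
          w ⟨m, by omega⟩ ≠ w ⟨m + 1, by omega⟩ := ⟨k, by omega, h1, h2, h3⟩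
      obtain ⟨m, hm, hP⟩ := hP
      refine ⟨_, Nat.findGreatest_spec (P := fun m => ∃ (_ : a ≤ m) (_ : m < a + d),
          w ⟨m, by omega⟩ ≠ w ⟨m + 1, by omega⟩) hm hP, fun q hq hq' => ?_⟩
      by_contra hne
      refine Nat.findGreatest_is_greatest hq (by omega) ⟨?_, hq', hne⟩
      have := Nat.le_findGreatest (P := fun m => ∃ (_ : a ≤ m) (_ : m < a + d),
          w ⟨m, by omega⟩ ≠ w ⟨m + 1, by omega⟩) hm hP
      exact hP.1.trans (this.trans hq.le)
    -- On [p + 1, a + d] the word `w` is constantly its letter at `a`. Rotation leaves these letters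
    -- unchanged and puts the same letter at `p`, continuing the block where `w` breaks it.
    refine hw _ p (by omega) (fun q hq => ?_) ?_ ?_ u
    · rcases lt_trichotomy q.1 (a + d) with h1 | h1 | h1
      · exact (rot_mid w a d h q.1 (by omega) h1).trans (hmax q hq h1).symm
      · rw [rot_last w a d h q h1, hlast]
        exact congrArg w.1 (Fin.ext h1.symm)
      · exact rot_of_gt w a d h q h1
    · rw [rot_mid w a d h p hp1 hp2]
      rcases Nat.eq_or_lt_of_le hp2 with h1 | h1
      · rw [rot_last w a d h _ h1, hlast]
        exact congrArg w.1 (Fin.ext h1)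
      · rw [rot_mid w a d h (p + 1) (by omega) h1]
        exact hmax (p + 1) (by omega) h1
    · rwa [rot_mid w a d h p hp1 hp2]
  · refine hU u hu _ ⟨⟨a + d, h⟩, le_rfl, ?_⟩
    rwa [rot_last w a d h _ rfl]

lemma IsExtremal.e_smul_mem_of_mem_shuffleSpan {w : SeqOf n ν} (hw : IsExtremal D K X w)
    {U W : Submodule K X}
    (hW : ∀ (k : ℕ) (hk : k + 1 < n), w ⟨k, by omega⟩ = w ⟨k + 1, hk⟩ →
      ∀ y ∈ W, R.t D K k hk w • y ∈ W)
    {a d : ℕ} (h : a + d < n) (hU' : ∀ l, l + 1 < a + d → IsCrossStable D n ν l U)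
    (hU : ∀ u ∈ U, ∀ j : SeqOf n ν, (∃ q : Fin n, a + d ≤ q.1 ∧ j q ≠ w q) → R.e D K j • u = 0)
    (hUW : ∀ u ∈ U, R.e D K w • u ∈ W) {y : X}
    (hy : y ∈ shuffleSpan D n ν U a d) : R.e D K w • y ∈ W := by
  induction d generalizing a y with
  | zero => exact hUW y hy
  | succ d ih =>
    obtain ⟨y₁, h₁, y₂, h₂, rfl⟩ := Submodule.mem_sup.1 (shuffleSpan_succ_le hU' hy)
    rw [smul_add]
    refine W.add_mem (ih (by omega) (fun l hl => hU' l (by omega)) (fun u hu j hj => ?_) h₁)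
      (hw.e_smul_mem_of_mem_strandSpan hW h hU hUW h₂)
    obtain ⟨q, hq, hne⟩ := hj
    exact hU u hu j ⟨q, by omega, hne⟩

/-- `U` stands in for what `W` generates using crossings of the first `m` strands only. The step to
`m + 1` inserts the strand at position `m`, counted from 0, anywhere to its left. That the words in
`U` agree with `w` from `m` on is carried along because the insertion argument consumes it. -/
lemma IsExtremal.exists_stable {w : SeqOf n ν} (hw : IsExtremal D K X w)
    {W : Submodule K X} (he : ∀ y ∈ W, R.e D K w • y = y)
    (hx : ∀ p, ∀ y ∈ W, R.x D K p w • y ∈ W)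
    (hW : ∀ (k : ℕ) (hk : k + 1 < n), w ⟨k, by omega⟩ = w ⟨k + 1, hk⟩ →
      ∀ y ∈ W, R.t D K k hk w • y ∈ W) (m : ℕ) (hm : m ≤ n) :
    ∃ U : Submodule K X, W ≤ U ∧ IsDotStable D (n := n) (ν := ν) U ∧
      (∀ l, l + 1 < m → IsCrossStable D n ν l U) ∧
      (∀ u ∈ U, ∀ j : SeqOf n ν, (∃ q : Fin n, m ≤ q.1 ∧ j q ≠ w q) → R.e D K j • u = 0) ∧
      ∀ u ∈ U, R.e D K w • u ∈ W := by
  induction m with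
  | zero =>
    have hne : ∀ j ≠ w, ∀ y ∈ W, R.e D K j • y = 0 := fun j hj y hy => by
      rw [← he y hy, smul_smul, R.e_mul_ne hj, zero_smul]
    refine ⟨W, le_rfl, ⟨fun i y hy => ?_, fun p i y hy => ?_⟩, fun l hl => by omega,
      fun u hu j hj => ?_, fun u hu => ?_⟩
    · by_cases hi : i = w
      · rwa [hi, he y hy]
      · rw [hne i hi y hy]
        exact W.zero_mem
    · by_cases hi : i = w
      · rw [hi]
        exact hx p y hy
      · rw [← R.x_mul_e, mul_smul, hne i hi y hy, smul_zero]
        exact W.zero_mem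
    · refine hne j ?_ u hu
      rintro rfl
      obtain ⟨q, -, hq⟩ := hj
      exact hq rfl
    · rwa [he u hu]
  | succ m ih =>
    obtain ⟨U, hWU, hU, hUc, hUs, hUW⟩ := ih (by omega)
    have h0 : 0 + m = m := zero_add m
    refine ⟨shuffleSpan D n ν U 0 m, hWU.trans le_shuffleSpan, hU.shuffleSpan,
      fun l hl => ?_, fun u hu j hj => ?_, fun u hu => ?_⟩
    · exact isCrossStable_shuffleSpan_of_le hU (by rwa [h0]) (by omega) (by omega)
    · refine e_smul_eq_zero_of_mem_shuffleSpan w m h0.le (fun u hu j hj => ?_) hu j ?_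
      · obtain ⟨q, hq, hne⟩ := hj
        exact hUs u hu j ⟨q, hq.le, hne⟩
      · exact hj
    · exact hw.e_smul_mem_of_mem_shuffleSpan hW (by omega) (by rwa [h0]) (by rwa [h0]) hUW hu

lemma R.smul_mem_of_forall_gen {V : Submodule K X}
    (hV : ∀ (g : Gen n ν), ∀ y ∈ V, R.gen D K g • y ∈ V) (r : R D K n ν) {y : X} (hy : y ∈ V) :
    r • y ∈ V := by
  obtain ⟨f, rfl⟩ := R.proj_surjective r
  induction f using FreeAlgebra.induction generalizing y with
  | grade0 c =>
    rw [AlgHom.commutes, algebraMap_smul]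
    exact V.smul_mem _ hy
  | grade1 g => exact hV g y hy
  | mul a b ha hb => rw [map_mul, mul_smul]; exact ha (hb hy)
  | add a b ha hb => rw [map_add, add_smul]; exact V.add_mem (ha hy) (hb hy)

/-- If `w` is extremal for `X`, then the part of sequence `w` of the submodule generated by a
subspace `W` of `1_w X` stable under dots and the crossings of equal letters of `w` is `W`. -/
lemma IsExtremal.e_smul_smul_mem {w : SeqOf n ν} (hw : IsExtremal D K X w)
    {W : Submodule K X} (he : ∀ y ∈ W, R.e D K w • y = y)
    (hx : ∀ p, ∀ y ∈ W, R.x D K p w • y ∈ W)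
    (hW : ∀ (k : ℕ) (hk : k + 1 < n), w ⟨k, by omega⟩ = w ⟨k + 1, hk⟩ →
      ∀ y ∈ W, R.t D K k hk w • y ∈ W) (r : R D K n ν) {y : X} (hy : y ∈ W) :
    R.e D K w • r • y ∈ W := by
  -- For m = n the subspace is stable under all generators, hence under R(ν).
  obtain ⟨U, hWU, hU, hUc, -, hUW⟩ := hw.exists_stable he hx hW n le_rfl
  refine hUW _ (R.smul_mem_of_forall_gen ?_ r (hWU hy))
  rintro (i | ⟨p, i⟩ | ⟨k, hk, i⟩)
  · exact hU.e_smul_mem i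
  · exact hU.x_smul_mem p i
  · exact hUc k hk hk i

end Shuffle

end QuiverHecke

/-! ### Common kernel vectors of nilCoxeter operators. -/

namespace QuiverHecke

/-- Operators satisfying the nilCoxeter relations have a common kernel vector. -/
lemma exists_forall_apply_eq_zero_of_nilCoxeter {X : Type*} [AddCommGroup X]
    (T : ℕ → X →+ X) (hsq : ∀ k y, T k (T k y) = 0)
    (hfar : ∀ k l y, k + 1 < l → T k (T l y) = T l (T k y))
    (hbraid : ∀ k y, T k (T (k + 1) (T k y)) = T (k + 1) (T k (T (k + 1) y)))
    (P : X → Prop) (hP : ∀ k y, P y → T k y ≠ 0 → P (T k y)) {y : X} (hy : P y) (m : ℕ) :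
    ∃ z, P z ∧ ∀ k < m, T k z = 0 := by
  induction m with
  | zero => exact ⟨y, hy, fun k hk => by omega⟩
  | succ m ih =>
    obtain ⟨z, hz, hkill⟩ := ih
    -- The candidates are z, T_m z, T_{m-1} T_m z, and so on. The current `y` is killed by all T_k
    -- with k ≤ m except perhaps T_{a-1}, and T_a T_{a-1} y = 0 if a ≤ m. If T_{a-1} y is nonzero it
    -- replaces `y`, and the braid relation restores the second condition.
    have key : ∀ a y, P y → (∀ k ≤ m, k + 1 ≠ a → T k y = 0) →
        (∀ k, k + 1 = a → a ≤ m → T a (T k y) = 0) → a ≤ m + 1 →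
        ∃ z, P z ∧ ∀ k < m + 1, T k z = 0 := by
      intro a
      induction a with
      | zero => exact fun y hy h _ _ => ⟨y, hy, fun k hk => h k (by omega) (by omega)⟩
      | succ a ih =>
        intro y hy h h' ha
        by_cases h0 : T a y = 0
        · refine ⟨y, hy, fun k hk => ?_⟩
          by_cases hka : k = a
          · rwa [hka]
          · exact h k (by omega) (by omega)
        refine ih _ (hP a y hy h0) (fun k hk hne => ?_) (fun k hk hkm => ?_) (by omega)
        · rcases lt_trichotomy k a with hlt | rfl | hlt
          · rw [hfar k a y (by omega), h k hk (by omega), map_zero]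
          · exact hsq _ _
          · rcases Nat.eq_or_lt_of_le hlt with rfl | hlt
            · exact h' a rfl hk
            · rw [← hfar a k y hlt, h k hk (by omega), map_zero]
        · subst hk
          rw [← hbraid, h k (by omega) (by omega), map_zero, map_zero]
    exact key (m + 1) z hz (fun k hk hne => hkill k (by omega)) (fun k _ h => by omega) le_rfl

section

open SeqOf

variable {I : Type v} [DecidableEq I] [Fintype I] {D : BorcherdsCartanDatum I}
  {K : Type u} [Field K] {n : ℕ} {ν : I →₀ ℕ}

/-! ### The grading of R(ν). -/

namespace R

lemma gen_mem_grade (g : Gen n ν) : gen D K g ∈ grade D K n ν (g.deg D) :=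
  Submodule.subset_span ⟨[g], by simp, by simp⟩

lemma one_mem_grade : (1 : R D K n ν) ∈ grade D K n ν 0 :=
  Submodule.subset_span ⟨[], by simp, by simp⟩

lemma mul_mem_grade {c d : ℤ} {a b : R D K n ν} (ha : a ∈ grade D K n ν c)
    (hb : b ∈ grade D K n ν d) : a * b ∈ grade D K n ν (c + d) := by
  have : grade D K n ν c * grade D K n ν d ≤ grade D K n ν (c + d) := by
    rw [grade, grade, Submodule.span_mul_span, Submodule.span_le]
    rintro _ ⟨_, ⟨w, hw, rfl⟩, _, ⟨w', hw', rfl⟩, rfl⟩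
    exact Submodule.subset_span ⟨w ++ w', by simp [hw, hw'], by simp⟩
  exact this (Submodule.mul_mem_mul ha hb)

lemma iSup_grade : ⨆ d, grade D K n ν d = ⊤ := by
  refine eq_top_iff.2 fun r _ => ?_
  obtain ⟨f, rfl⟩ := proj_surjective r
  induction f using FreeAlgebra.induction with
  | grade0 c =>
    rw [AlgHom.commutes, Algebra.algebraMap_eq_smul_one]
    exact Submodule.smul_mem _ _ (Submodule.mem_iSup_of_mem 0 one_mem_grade)
  | grade1 g => exact Submodule.mem_iSup_of_mem _ (gen_mem_grade g)
  | mul a b ha hb =>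
    rw [map_mul]
    have : (⨆ d, grade D K n ν d) * (⨆ d, grade D K n ν d) ≤ ⨆ d, grade D K n ν d := by
      rw [Submodule.iSup_mul]
      refine iSup_le fun c => ?_
      rw [Submodule.mul_iSup]
      refine iSup_le fun d => Submodule.mul_le.2 fun a ha b hb => ?_
      exact Submodule.mem_iSup_of_mem _ (mul_mem_grade ha hb)
    exact this (Submodule.mul_mem_mul (ha trivial) (hb trivial))
  | add a b ha hb =>
    rw [map_add]
    exact Submodule.add_mem _ (ha trivial) (hb trivial)

/-- Uniqueness of the components is not needed: their actions on a homogeneous vector of a graded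
module lie in different degrees (`GrMod.component_sum_smul`). -/
lemma exists_sum_grade (r : R D K n ν) : ∃ (s : Finset ℤ) (f : ℤ → R D K n ν),
    (∀ d, f d ∈ grade D K n ν d) ∧ (∀ d ∉ s, f d = 0) ∧ r = ∑ d ∈ s, f d := by
  have hr : r ∈ ⨆ d, grade D K n ν d := by rw [iSup_grade]; trivial
  rw [Submodule.mem_iSup_iff_exists_finsupp] at hr
  obtain ⟨f, hf, rfl⟩ := hr
  exact ⟨f.support, f, hf, fun d hd => Finsupp.notMem_support_iff.1 hd, rfl⟩

end R

/-! ### Singular vectors and the span of their dots. -/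

section DotSpan

variable {X : Type*} [AddCommGroup X] [Module K X] [Module (R D K n ν) X]

variable (D K) in
/-- The subspace spanned by the products of dots on the sequence `w`, applied to `y`. -/
def dotSpan (w : SeqOf n ν) (y : X) : Submodule K X :=
  Submodule.span K {z | ∃ L : List (Fin n), z = (L.map fun p => R.x D K p w).prod • y}

lemma self_mem_dotSpan (w : SeqOf n ν) (y : X) : y ∈ dotSpan D K w y :=
  Submodule.subset_span ⟨[], by simp⟩

variable [IsScalarTower K (R D K n ν) X]

lemma x_smul_mem_dotSpan {w : SeqOf n ν} {y z : X} (p : Fin n) (hz : z ∈ dotSpan D K w y) :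
    R.x D K p w • z ∈ dotSpan D K w y := by
  have : dotSpan D K w y ≤ (dotSpan D K w y).comap (Algebra.lsmul K K X (R.x D K p w)) := by
    refine Submodule.span_le.2 ?_
    rintro _ ⟨L, rfl⟩
    refine Submodule.subset_span ⟨p :: L, ?_⟩
    rw [List.map_cons, List.prod_cons, mul_smul]
    rfl
  exact this hz

lemma e_smul_of_mem_dotSpan {w : SeqOf n ν} {y z : X} (hy : R.e D K w • y = y)
    (hz : z ∈ dotSpan D K w y) : R.e D K w • z = z := by
  induction hz using Submodule.span_induction with
  | mem z hz =>
    obtain ⟨L, rfl⟩ := hz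
    cases L with
    | nil => simpa using hy
    | cons p L => rw [List.map_cons, List.prod_cons, smul_smul, ← mul_assoc, R.e_mul_x]
  | zero => exact smul_zero _
  | add a b _ _ ha hb => rw [smul_add, ha, hb]
  | smul c a _ ha => rw [smul_algebra_smul_comm, ha]

/-- The crossing slides past each dot up to a scalar and dies on reaching `y`. Thus the dot span of
a singular vector qualifies as `W` in `IsExtremal.e_smul_smul_mem`. -/
lemma t_smul_mem_dotSpan {w : SeqOf n ν} {y z : X} (hy : R.e D K w • y = y)
    {k : ℕ} (hk : k + 1 < n) (hw : w ⟨k, by omega⟩ = w ⟨k + 1, hk⟩)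
    (ht : R.t D K k hk w • y = 0) (hz : z ∈ dotSpan D K w y) :
    R.t D K k hk w • z ∈ dotSpan D K w y := by
  have : dotSpan D K w y ≤ (dotSpan D K w y).comap (Algebra.lsmul K K X (R.t D K k hk w)) := by
    refine Submodule.span_le.2 ?_
    rintro _ ⟨L, rfl⟩
    change R.t D K k hk w • (_ : X) ∈ dotSpan D K w y
    induction L with
    | nil =>
      rw [List.map_nil, List.prod_nil, one_smul, ht]
      exact Submodule.zero_mem _
    | cons p L ih =>
      have hL : (L.map fun p => R.x D K p w).prod • y ∈ dotSpan D K w y :=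
        Submodule.subset_span ⟨L, rfl⟩
      obtain ⟨q, c, h⟩ := R.exists_t_mul_x (D := D) (K := K) p k hk w
      rw [swap_eq_self k hk w hw] at h
      rw [List.map_cons, List.prod_cons, mul_smul, smul_smul, h, add_smul, mul_smul, smul_assoc,
        e_smul_of_mem_dotSpan hy hL]
      exact Submodule.add_mem _ (x_smul_mem_dotSpan q ih) (Submodule.smul_mem _ _ hL)
  exact this hz

variable (D K) in
/-- A vector of `1_w X` killed by all crossings of equal letters of `w`. -/
structure IsSingular (w : SeqOf n ν) (y : X) : Prop where
  e_smul : R.e D K w • y = y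
  t_smul : ∀ (k : ℕ) (hk : k + 1 < n), w ⟨k, by omega⟩ = w ⟨k + 1, hk⟩ → R.t D K k hk w • y = 0

lemma IsExtremal.e_smul_smul_mem_dotSpan {w : SeqOf n ν} (hw : IsExtremal D K X w) {y : X}
    (hy : IsSingular D K w y) (r : R D K n ν) : R.e D K w • r • y ∈ dotSpan D K w y :=
  hw.e_smul_smul_mem (fun _ hz => e_smul_of_mem_dotSpan hy.e_smul hz)
    (fun p _ hz => x_smul_mem_dotSpan p hz)
    (fun k hk h _ hz => t_smul_mem_dotSpan hy.e_smul hk h (hy.t_smul k hk h) hz) r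
    (self_mem_dotSpan w y)

end DotSpan

/-! ### Block crossings as nilCoxeter operators. -/

section NilCoxeter

variable (D K) in
open Classical in
/-- The crossing of the strands `k`, `k + 1` of `w` if their letters are equal, and `0` otherwise. -/
noncomputable def blockCross (w : SeqOf n ν) (k : ℕ) : R D K n ν :=
  if h : ∃ hk : k + 1 < n, w ⟨k, by omega⟩ = w ⟨k + 1, hk⟩ then R.t D K k h.1 w else 0

lemma blockCross_of_eq {w : SeqOf n ν} {k : ℕ} (hk : k + 1 < n)
    (h : w ⟨k, by omega⟩ = w ⟨k + 1, hk⟩) : blockCross D K w k = R.t D K k hk w :=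
  dif_pos ⟨hk, h⟩

lemma blockCross_mul_self (w : SeqOf n ν) (k : ℕ) :
    blockCross D K w k * blockCross D K w k = 0 := by
  by_cases h : ∃ hk : k + 1 < n, w ⟨k, by omega⟩ = w ⟨k + 1, hk⟩
  · have := R.t_mul_t_same (D := D) (K := K) k h.1 w h.2
    rw [swap_eq_self k h.1 w h.2] at this
    rwa [blockCross_of_eq h.1 h.2]
  · rw [blockCross, dif_neg h, zero_mul]

lemma blockCross_comm (w : SeqOf n ν) {k l : ℕ} (hkl : k + 1 < l) :
    blockCross D K w k * blockCross D K w l = blockCross D K w l * blockCross D K w k := by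
  by_cases h : ∃ hk : k + 1 < n, w ⟨k, by omega⟩ = w ⟨k + 1, hk⟩
  · by_cases h' : ∃ hl : l + 1 < n, w ⟨l, by omega⟩ = w ⟨l + 1, hl⟩
    · have := R.t_mul_t_far (D := D) (K := K) k l h.1 h'.1 (Or.inl hkl) w
      rw [swap_eq_self k h.1 w h.2, swap_eq_self l h'.1 w h'.2] at this
      rwa [blockCross_of_eq h.1 h.2, blockCross_of_eq h'.1 h'.2]
    · rw [blockCross, blockCross, dif_neg h', zero_mul, mul_zero]
  · rw [blockCross, dif_neg h, zero_mul, mul_zero]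

/-- The default value 0 across a change of letter is harmless, since both sides contain both
factors. -/
lemma blockCross_braid (w : SeqOf n ν) (k : ℕ) :
    blockCross D K w k * blockCross D K w (k + 1) * blockCross D K w k =
      blockCross D K w (k + 1) * blockCross D K w k * blockCross D K w (k + 1) := by
  by_cases h : ∃ hk : k + 1 < n, w ⟨k, by omega⟩ = w ⟨k + 1, hk⟩
  · by_cases h' : ∃ hk : k + 1 + 1 < n, w ⟨k + 1, by omega⟩ = w ⟨k + 1 + 1, hk⟩
    · have := R.braid_of_eq (D := D) (K := K) k h'.1 w h.2
      rw [swap_eq_self k h.1 w h.2, swap_eq_self (k + 1) h'.1 w h'.2,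
        swap_eq_self k h.1 w h.2] at this
      rwa [blockCross_of_eq h.1 h.2, blockCross_of_eq h'.1 h'.2]
    · simp only [blockCross, dif_neg h', zero_mul, mul_zero]
  · simp only [blockCross, dif_neg h, zero_mul, mul_zero]

lemma e_mul_blockCross (w : SeqOf n ν) (k : ℕ) :
    R.e D K w * blockCross D K w k = blockCross D K w k := by
  by_cases h : ∃ hk : k + 1 < n, w ⟨k, by omega⟩ = w ⟨k + 1, hk⟩
  · have := R.e_mul_t (D := D) (K := K) k h.1 w
    rw [swap_eq_self k h.1 w h.2] at this
    rwa [blockCross_of_eq h.1 h.2]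
  · rw [blockCross, dif_neg h, mul_zero]

lemma exists_blockCross_mem_grade (w : SeqOf n ν) (k : ℕ) :
    ∃ d, blockCross D K w k ∈ R.grade D K n ν d := by
  by_cases h : ∃ hk : k + 1 < n, w ⟨k, by omega⟩ = w ⟨k + 1, hk⟩
  · rw [blockCross_of_eq h.1 h.2]
    exact ⟨_, R.gen_mem_grade _⟩
  · rw [blockCross, dif_neg h]
    exact ⟨0, Submodule.zero_mem _⟩

namespace GrMod

/-- If `1_w M` is nonzero, it contains a homogeneous singular vector. -/
lemma exists_isSingular (M : GrMod D K n ν) (w : SeqOf n ν)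
    (h : ∃ y : M.carrier, R.e D K w • y ≠ 0) :
    ∃ (d : ℤ) (y : M.carrier), y ∈ M.deg d ∧ y ≠ 0 ∧ IsSingular D K w y := by
  obtain ⟨d, y, hy, hy0⟩ : ∃ (d : ℤ) (y : M.carrier), y ∈ M.deg d ∧ R.e D K w • y ≠ 0 := by
    by_contra! hc
    obtain ⟨y, hy⟩ := h
    have := M.eq_of_eq_on_deg (Algebra.lsmul K K M.carrier (R.e D K w)) 0
      (fun d x hx => hc d x hx)
    exact hy (LinearMap.congr_fun this y)
  obtain ⟨z, ⟨⟨c, hc⟩, hz0, hz⟩, hk⟩ := exists_forall_apply_eq_zero_of_nilCoxeter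
    (fun k => DistribSMul.toAddMonoidHom M.carrier (blockCross D K w k))
    (fun k y => by simp [smul_smul, blockCross_mul_self])
    (fun k l y hkl => by simp [smul_smul, blockCross_comm w hkl])
    (fun k y => by simp [smul_smul, ← mul_assoc, blockCross_braid])
    (fun y => (∃ d, y ∈ M.deg d) ∧ y ≠ 0 ∧ R.e D K w • y = y)
    (fun k y ⟨⟨d, hd⟩, _, hy⟩ h0 => by
      obtain ⟨c, hc⟩ := exists_blockCross_mem_grade (D := D) (K := K) w k
      refine ⟨⟨c + d, M.smul_mem _ _ _ _ hc hd⟩, h0, ?_⟩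
      simp [smul_smul, e_mul_blockCross])
    (y := R.e D K w • y)
    ⟨⟨d, M.e_smul_mem w d y hy⟩, hy0, by rw [smul_smul, R.e_mul_self]⟩ n
  refine ⟨c, z, hc, hz0, hz, fun k hk' h => ?_⟩
  rw [← blockCross_of_eq hk' h]
  exact hk k (by omega)

end GrMod

end NilCoxeter

end

end QuiverHecke

/-! ### The order on sequences. -/

namespace QuiverHecke

section

variable {I : Type v} [DecidableEq I] [Fintype I] {D : BorcherdsCartanDatum I}
  {K : Type u} [Field K] {n : ℕ} {ν : I →₀ ℕ}

/-- Sequences are compared from the right; at each position the letter equal to its right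
neighbour is the largest one. -/
noncomputable def SeqOf.key (i : SeqOf n ν) : Colex (Fin n → WithTop (Fin (Fintype.card I))) :=
  toColex fun p => if ∃ h : p.1 + 1 < n, i p = i ⟨p.1 + 1, h⟩ then ⊤ else
    ((Fintype.equivFin I (i p) : Fin (Fintype.card I)) : WithTop (Fin (Fintype.card I)))

/-- A key is decoded from the right: ⊤ means "copy the right neighbour", any other value names the
letter. -/
lemma SeqOf.key_injective : Function.Injective (SeqOf.key (n := n) (ν := ν)) := by
  intro i j hij
  refine Subtype.ext (funext fun p => ?_)
  obtain ⟨m, hm⟩ : ∃ m, p.1 + m = n := ⟨n - p.1, by omega⟩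
  induction m using Nat.strong_induction_on generalizing p with
  | _ m ih =>
    have hp := congrFun (congrArg ofColex hij) p
    simp only [key, ofColex_toColex] at hp
    split_ifs at hp with h1 h2 h2
    · obtain ⟨h, h1⟩ := h1
      obtain ⟨_, h2⟩ := h2
      exact h1.trans ((ih (m - 1) (by omega) ⟨p.1 + 1, h⟩ (by simp; omega)).trans h2.symm)
    · exact absurd hp.symm WithTop.coe_ne_top
    · exact absurd hp WithTop.coe_ne_top
    · exact (Fintype.equivFin I).injective (WithTop.coe_injective hp)

/-- Ranking repeated letters highest makes every word dominating `w`, in the sense of `IsExtremal`,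
larger than `w`. Beyond `p` the keys agree because the key at q involves only the letters at q and q
+ 1. -/
lemma SeqOf.key_lt {j w : SeqOf n ν} {p : ℕ} (hp : p + 1 < n)
    (h : ∀ q : Fin n, p < q.1 → j q = w q) (hj : j ⟨p, by omega⟩ = j ⟨p + 1, hp⟩)
    (hw : w ⟨p, by omega⟩ ≠ j ⟨p, by omega⟩) : w.key < j.key := by
  refine ⟨⟨p, by omega⟩, fun q hq => ?_, ?_⟩
  · have hq' : p < q.1 := hq
    have e1 := h q hq'
    have e2 : ∀ h' : q.1 + 1 < n, j ⟨q.1 + 1, h'⟩ = w ⟨q.1 + 1, h'⟩ :=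
      fun h' => h ⟨q.1 + 1, h'⟩ (Nat.lt_succ_of_lt hq')
    simp only [key, Pi.toColex_apply, e1, e2]
  · have h1 : ∃ h : p + 1 < n, j ⟨p, by omega⟩ = j ⟨p + 1, h⟩ := ⟨hp, hj⟩
    have h2 : ¬ ∃ h : p + 1 < n, w ⟨p, by omega⟩ = w ⟨p + 1, h⟩ := by
      rintro ⟨_, h2⟩
      rw [h2, hj] at hw
      exact hw (h _ (by simp)).symm
    simp only [key, Pi.toColex_apply, if_pos h1, if_neg h2]
    exact WithTop.coe_lt_top _

/-! ### Leading sequences determine irreducible modules. -/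

namespace GrMod

/-- `w` is the largest sequence with `1_w M ≠ 0`. -/
structure IsLeading (M : GrMod D K n ν) (w : SeqOf n ν) : Prop where
  exists_ne : ∃ y : M.carrier, R.e D K w • y ≠ 0
  le : ∀ j : SeqOf n ν, (∃ y : M.carrier, R.e D K j • y ≠ 0) → j.key ≤ w.key

lemma exists_isLeading (M : GrMod D K n ν) [Nontrivial M.carrier] : ∃ w, M.IsLeading w := by
  classical
  obtain ⟨y, hy⟩ := exists_ne (0 : M.carrier)
  have hs : ∃ w : SeqOf n ν, R.e D K w • y ≠ 0 := by
    by_contra! hc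
    apply hy
    rw [← one_smul (R D K n ν) y, ← R.sum_e, Finset.sum_smul, Finset.sum_eq_zero fun i _ => hc i]
  obtain ⟨w₀, hw₀⟩ := hs
  obtain ⟨w, hw, hmax⟩ := Finset.exists_max_image
    (Finset.univ.filter fun w : SeqOf n ν => ∃ y : M.carrier, R.e D K w • y ≠ 0) SeqOf.key
    ⟨w₀, by simpa using ⟨y, hw₀⟩⟩
  exact ⟨w, by simpa using hw, fun j hj => hmax j (by simpa using hj)⟩

lemma IsLeading.isExtremal {M : GrMod D K n ν} {w : SeqOf n ν} (h : M.IsLeading w) :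
    IsExtremal D K M.carrier w := by
  intro j p hp h1 h2 h3 y
  by_contra hy
  exact (h.le j ⟨y, hy⟩).not_gt (SeqOf.key_lt hp h1 h2 h3)

/-- The components of a homogeneous decomposition of a scalar acting on a homogeneous vector. -/
lemma component_sum_smul (M : GrMod D K n ν) {d : ℤ} {y : M.carrier} (hy : y ∈ M.deg d)
    {s : Finset ℤ} {f : ℤ → R D K n ν} (hf : ∀ c, f c ∈ R.grade D K n ν c)
    (hs : ∀ c ∉ s, f c = 0) {p : M.carrier →ₗ[K] M.carrier} {c : ℤ}
    (hp : ∀ x ∈ M.deg (c + d), p x = x) (hp' : ∀ b ≠ c + d, ∀ x ∈ M.deg b, p x = 0) :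
    p ((∑ b ∈ s, f b) • y) = f c • y := by
  rw [Finset.sum_smul, map_sum, Finset.sum_eq_single c]
  · exact hp _ (M.smul_mem _ _ _ _ (hf c) hy)
  · intro b _ hb
    exact hp' (b + d) (by omega) _ (M.smul_mem _ _ _ _ (hf b) hy)
  · intro hc
    rw [hs c hc, zero_smul, map_zero]

lemma isGradedSubmodule_map (M : GrMod D K n ν) {d : ℤ} {y : M.carrier} (hy : y ∈ M.deg d)
    (J : Submodule (R D K n ν) (R D K n ν))
    (hJ : ∀ r ∈ J, ∃ (s : Finset ℤ) (f : ℤ → R D K n ν),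
      (∀ c, f c ∈ R.grade D K n ν c) ∧ (∀ c, f c ∈ J) ∧ r = ∑ c ∈ s, f c) :
    M.IsGradedSubmodule (J.map (LinearMap.toSpanSingleton (R D K n ν) M.carrier y)) := by
  rintro _ ⟨r, hr, rfl⟩
  obtain ⟨s, f, hf, hfJ, rfl⟩ := hJ r hr
  rw [LinearMap.toSpanSingleton_apply, Finset.sum_smul]
  refine Submodule.sum_mem _ fun c _ => Submodule.mem_iSup_of_mem (c + d) ⟨?_, ?_⟩
  · exact ⟨f c, hfJ c, rfl⟩
  · exact M.smul_mem _ _ _ _ (hf c) hy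

/-- A nonzero homogeneous vector generates a gr-irreducible module. -/
lemma IsGrIrreducible.toSpanSingleton_surjective {M : GrMod D K n ν} (hM : M.IsGrIrreducible)
    {d : ℤ} {y : M.carrier} (hy : y ∈ M.deg d) (hy0 : y ≠ 0) :
    Function.Surjective (LinearMap.toSpanSingleton (R D K n ν) M.carrier y) := by
  rw [← LinearMap.range_eq_top, LinearMap.range_eq_map]
  refine (hM.2 _ (M.isGradedSubmodule_map hy ⊤ fun r _ => ?_)).resolve_left fun h => hy0 ?_
  · obtain ⟨s, f, hf, -, h⟩ := R.exists_sum_grade r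
    exact ⟨s, f, hf, fun _ => trivial, h⟩
  · have : y ∈ (⊤ : Submodule (R D K n ν) (R D K n ν)).map
        (LinearMap.toSpanSingleton (R D K n ν) M.carrier y) := ⟨1, trivial, by simp⟩
    rwa [h, Submodule.mem_bot] at this

/-- If r kills the homogeneous vector `y`, so does each component of r, as their values on `y` lie
in different degrees of `M`. -/
lemma isGradedSubmodule_map_ker (M N : GrMod D K n ν) {c d : ℤ} {y : M.carrier} {z : N.carrier}
    (hy : y ∈ M.deg c) (hz : z ∈ N.deg d) :
    N.IsGradedSubmodule ((LinearMap.ker (LinearMap.toSpanSingleton (R D K n ν) M.carrier y)).map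
      (LinearMap.toSpanSingleton (R D K n ν) N.carrier z)) := by
  refine N.isGradedSubmodule_map hz _ fun r hr => ?_
  obtain ⟨s, f, hf, hs, rfl⟩ := R.exists_sum_grade r
  refine ⟨s, f, hf, fun b => ?_, rfl⟩
  obtain ⟨p, -, hp, hp'⟩ := M.exists_proj (b + c)
  rw [LinearMap.mem_ker, LinearMap.toSpanSingleton_apply] at hr ⊢
  rw [← M.component_sum_smul hy hf hs hp hp', hr, map_zero]

/-- Here r_i > 0 enters: every nonempty product of dots strictly raises degrees. -/
lemma prod_dots_mem_grade (w : SeqOf n ν) (L : List (Fin n)) :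
    ∃ d, 0 ≤ d ∧ (L ≠ [] → 0 < d) ∧
      (L.map fun p => R.x D K p w).prod ∈ R.grade D K n ν d := by
  induction L with
  | nil => exact ⟨0, le_rfl, by simp, by simpa using R.one_mem_grade⟩
  | cons p L ih =>
    obtain ⟨d, hd, -, h⟩ := ih
    have hr := D.r_pos (w p)
    refine ⟨2 * D.r (w p) + d, by omega, fun _ => by omega, ?_⟩
    rw [List.map_cons, List.prod_cons]
    exact R.mul_mem_grade (R.gen_mem_grade (.x p w)) h

/-- In its lowest degree, the subspace spanned by the dots applied to a pair of homogeneous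
vectors is spanned by this pair. -/
lemma proj_dotSpan (M N : GrMod D K n ν) {c d : ℤ} {y : M.carrier} {z : N.carrier}
    (hy : y ∈ M.deg c) (hz : z ∈ N.deg d) (w : SeqOf n ν)
    {p : M.carrier →ₗ[K] M.carrier} (hp : ∀ x ∈ M.deg c, p x = x)
    (hp' : ∀ b ≠ c, ∀ x ∈ M.deg b, p x = 0)
    {q : N.carrier →ₗ[K] N.carrier} (hq : ∀ x ∈ N.deg d, q x = x)
    (hq' : ∀ b ≠ d, ∀ x ∈ N.deg b, q x = 0)
    {m : M.carrier × N.carrier} (hm : m ∈ dotSpan D K w (y, z)) :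
    ∃ a : K, p m.1 = a • y ∧ q m.2 = a • z := by
  induction hm using Submodule.span_induction with
  | mem m hm =>
    obtain ⟨L, rfl⟩ := hm
    by_cases hL : L = []
    · subst hL
      exact ⟨1, by simp [hp y hy], by simp [hq z hz]⟩
    · obtain ⟨b, -, hb, h⟩ := prod_dots_mem_grade (D := D) (K := K) w L
      have := hb hL
      refine ⟨0, ?_, ?_⟩
      · rw [zero_smul]
        exact hp' (b + c) (by omega) _ (M.smul_mem _ _ _ _ h hy)
      · rw [zero_smul]
        exact hq' (b + d) (by omega) _ (N.smul_mem _ _ _ _ h hz)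
  | zero => exact ⟨0, by simp, by simp⟩
  | add m m' _ _ h h' =>
    obtain ⟨a, h1, h2⟩ := h
    obtain ⟨a', h1', h2'⟩ := h'
    exact ⟨a + a', by simp [h1, h1', add_smul], by simp [h2, h2', add_smul]⟩
  | smul b m _ h =>
    obtain ⟨a, h1, h2⟩ := h
    exact ⟨b * a, by simp [h1, mul_smul], by simp [h2, mul_smul]⟩

/-- Homogeneous singular vectors of the same leading sequence have comparable annihilators. -/
lemma smul_eq_zero_of_isSingular (M N : GrMod D K n ν) (hN : N.IsGrIrreducible) {w : SeqOf n ν}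
    (hMw : IsExtremal D K M.carrier w) (hNw : IsExtremal D K N.carrier w)
    {c d : ℤ} {y : M.carrier} {z : N.carrier} (hy : y ∈ M.deg c) (hz : z ∈ N.deg d)
    (hy0 : y ≠ 0) (hz0 : z ≠ 0) (hys : IsSingular D K w y) (hzs : IsSingular D K w z)
    (r : R D K n ν) (hr : r • y = 0) : r • z = 0 := by
  -- Ann(y) z is a graded submodule of `N`; the point is to exclude that it is all of `N`.
  rcases hN.2 _ (M.isGradedSubmodule_map_ker N hy hz) with h | h
  · have : r • z ∈ (LinearMap.ker (LinearMap.toSpanSingleton (R D K n ν) M.carrier y)).map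
        (LinearMap.toSpanSingleton (R D K n ν) N.carrier z) := ⟨r, hr, rfl⟩
    rwa [h, Submodule.mem_bot] at this
  · exfalso
    obtain ⟨s, hs, hsz⟩ : z ∈ (LinearMap.ker
        (LinearMap.toSpanSingleton (R D K n ν) M.carrier y)).map
        (LinearMap.toSpanSingleton (R D K n ν) N.carrier z) := by rw [h]; trivial
    replace hs : s • y = 0 := hs
    replace hsz : s • z = z := hsz
    -- The vector 1_w s (y, z) = (0, z) would lie in the dot span of (y, z). Projected to degrees
    -- `c` and `d`, that span contains only multiples of (y, z).
    have hX : IsExtremal D K (M.carrier × N.carrier) w := fun j p hp h1 h2 h3 m =>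
      Prod.ext (hMw j p hp h1 h2 h3 m.1) (hNw j p hp h1 h2 h3 m.2)
    have hS : IsSingular D K w (y, z) := ⟨Prod.ext hys.e_smul hzs.e_smul,
      fun k hk hw => Prod.ext (hys.t_smul k hk hw) (hzs.t_smul k hk hw)⟩
    have hm := hX.e_smul_smul_mem_dotSpan hS s
    obtain ⟨p, -, hp, hp'⟩ := M.exists_proj c
    obtain ⟨q, -, hq, hq'⟩ := N.exists_proj d
    obtain ⟨a, h1, h2⟩ := M.proj_dotSpan N hy hz w hp hp' hq hq' hm
    simp only [Prod.smul_mk, hs, hsz, smul_zero, map_zero, hzs.e_smul, hq z hz] at h1 h2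
    have ha : a = 0 := (smul_eq_zero.1 h1.symm).resolve_right hy0
    rw [ha, zero_smul] at h2
    exact hz0 h2

lemma isIso_of_forall_mem {M N : GrMod D K n ν} (f : M.carrier ≃ₗ[R D K n ν] N.carrier)
    (hf : ∀ d, ∀ x ∈ M.deg d, f x ∈ N.deg d) : IsIso M N := by
  refine ⟨f, fun d x => ⟨fun h => ?_, hf d x⟩⟩
  obtain ⟨p, hp1, hp2, hp3⟩ := M.exists_proj d
  obtain ⟨q, -, hq2, hq3⟩ := N.exists_proj d
  have := M.eq_of_eq_on_deg (q ∘ₗ f.toLinearMap.restrictScalars K)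
    (f.toLinearMap.restrictScalars K ∘ₗ p) fun c x hx => by
      by_cases hc : c = d
      · subst hc
        simp [hp2 x hx, hq2 _ (hf _ _ hx)]
      · simp [hp3 c hc x hx, hq3 c hc _ (hf _ _ hx)]
  have hx : q (f x) = f (p x) := LinearMap.congr_fun this x
  rw [hq2 _ h] at hx
  rw [f.injective hx]
  exact hp1 x

/-- A gr-irreducible module is determined up to isomorphism and shift by its leading sequence. -/
lemma IsGrIrreducible.isIsoUpToShift {M N : GrMod D K n ν} (hM : M.IsGrIrreducible)
    (hN : N.IsGrIrreducible) {w : SeqOf n ν} (hMw : M.IsLeading w) (hNw : N.IsLeading w) :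
    IsIsoUpToShift M N := by
  obtain ⟨c, y, hy, hy0, hys⟩ := M.exists_isSingular w hMw.exists_ne
  obtain ⟨d, z, hz, hz0, hzs⟩ := N.exists_isSingular w hNw.exists_ne
  have hker : LinearMap.ker (LinearMap.toSpanSingleton (R D K n ν) M.carrier y) =
      LinearMap.ker (LinearMap.toSpanSingleton (R D K n ν) N.carrier z) := by
    ext r
    exact ⟨M.smul_eq_zero_of_isSingular N hN hMw.isExtremal hNw.isExtremal hy hz hy0 hz0 hys hzs r,
      N.smul_eq_zero_of_isSingular M hM hNw.isExtremal hMw.isExtremal hz hy hz0 hy0 hzs hys r⟩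
  have hsM := hM.toSpanSingleton_surjective hy hy0
  have hsN := hN.toSpanSingleton_surjective hz hz0
  let f : M.carrier ≃ₗ[R D K n ν] N.carrier :=
    (LinearMap.quotKerEquivOfSurjective _ hsM).symm ≪≫ₗ Submodule.quotEquivOfEq _ _ hker ≪≫ₗ
      LinearMap.quotKerEquivOfSurjective _ hsN
  have hf : ∀ r : R D K n ν, f (r • y) = r • z := by
    intro r
    have : (LinearMap.quotKerEquivOfSurjective _ hsM).symm (r • y) = Submodule.Quotient.mk r := by
      rw [LinearEquiv.symm_apply_eq]
      rfl
    simp only [f, LinearEquiv.trans_apply, this]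
    rfl
  -- The map sends `y`, of degree `c`, to `z`, of degree `d`, which dictates the shift.
  refine ⟨c - d, isIso_of_forall_mem (N := N.shift (c - d)) f fun b x hx => ?_⟩
  change f x ∈ N.deg (b - (c - d))
  obtain ⟨r, rfl⟩ := hsM x
  rw [LinearMap.toSpanSingleton_apply] at hx ⊢
  obtain ⟨s, g, hg, hs, rfl⟩ := R.exists_sum_grade r
  obtain ⟨p, -, hp, hp'⟩ := M.exists_proj ((b - c) + c)
  have h1 := M.component_sum_smul hy hg hs hp hp'
  rw [hp _ (by rwa [sub_add_cancel])] at h1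
  rw [h1, hf, show b - (c - d) = (b - c) + d by ring]
  exact N.smul_mem _ _ _ _ (hg _) hz

/-! ### Triangularity of characters. -/

lemma character_apply (M : GrMod D K n ν) (i : SeqOf n ν) : M.character i = M.gdim i := by
  rw [character, Finsupp.finsetSum_apply, Finset.sum_eq_single i]
  · rw [Finsupp.single_eq_same]
  · intro j _ hj
    rw [Finsupp.single_eq_of_ne hj.symm]
  · simp

lemma gdim_eq_zero (M : GrMod D K n ν) {i : SeqOf n ν}
    (h : ∀ y : M.carrier, R.e D K i • y = 0) : M.gdim i = 0 := by
  have : ∀ d, M.piece i d = ⊥ := fun d => by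
    rw [eq_bot_iff]
    rintro _ ⟨y, -, rfl⟩
    exact h y
  refine finsum_eq_zero_of_forall_eq_zero fun d => ?_
  rw [this, finrank_bot, Nat.cast_zero, zero_mul]

lemma gdim_ne_zero (M : GrMod D K n ν) {i : SeqOf n ν}
    (h : ∃ y : M.carrier, R.e D K i • y ≠ 0) : M.gdim i ≠ 0 := by
  obtain ⟨d, hd⟩ : ∃ d, M.piece i d ≠ ⊥ := by
    by_contra! hc
    obtain ⟨y, hy⟩ := h
    have := M.eq_of_eq_on_deg (Algebra.lsmul K K M.carrier (R.e D K i)) 0 fun d x hx => by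
      have : R.e D K i • x ∈ M.piece i d := ⟨x, hx, rfl⟩
      rwa [hc, Submodule.mem_bot] at this
    exact hy (LinearMap.congr_fun this y)
  -- Evaluation at q = 1 gives a sum of nonnegative dimensions, where nothing cancels.
  let φ : ℤ[T;T⁻¹] →ₐ[ℤ] ℤ := AddMonoidAlgebra.lift ℤ ℤ ℤ 1
  have hφ : ∀ d, φ (LaurentPolynomial.T d) = 1 := fun d => by
    change AddMonoidAlgebra.lift ℤ ℤ ℤ 1 (AddMonoidAlgebra.single d 1) = 1
    rw [AddMonoidAlgebra.lift_single]
    simp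
  intro h0
  have h1 := congrArg φ h0
  rw [gdim, finsum_eq_sum _ (M.finite_support i), map_sum, map_zero] at h1
  simp only [map_mul, map_natCast, hφ, mul_one] at h1
  have h2 := (Finset.sum_eq_zero_iff_of_nonneg fun _ _ => Int.natCast_nonneg _).1 h1 d
  have h3 : Module.finrank K (M.piece i d) ≠ 0 := fun h =>
    hd (Submodule.finrank_eq_zero.1 h)
  refine h3 (Int.natCast_eq_zero.1 (h2 ?_))
  rw [Set.Finite.mem_toFinset, Function.mem_support]
  intro h4
  have h5 := congrArg φ h4
  rw [map_mul, map_natCast, hφ, mul_one, map_zero] at h5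
  exact h3 (Int.natCast_eq_zero.1 h5)

/-- Characters with distinct leading sequences are linearly independent. -/
lemma linearIndependent_character {B : Type*} (S : B → GrMod D K n ν) (w : B → SeqOf n ν)
    (hw : ∀ b, (S b).IsLeading (w b)) (hinj : Function.Injective w) :
    LinearIndependent ℤ[T;T⁻¹] fun b => (S b).character := by
  classical
  rw [linearIndependent_iff']
  intro s g hg b hb
  by_contra hgb
  -- Among the indices with nonzero coefficient, take the one with the largest leading sequence; the
  -- other characters in the relation have no term there.
  obtain ⟨c, hc, hmax⟩ := Finset.exists_max_image (s.filter fun b => g b ≠ 0)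
    (fun b => (w b).key) ⟨b, by simp [hb, hgb]⟩
  rw [Finset.mem_filter] at hc
  have h := DFunLike.congr_fun hg (w c)
  rw [Finsupp.finsetSum_apply, Finset.sum_eq_single c] at h
  · rw [Finsupp.smul_apply, character_apply, Finsupp.zero_apply, smul_eq_mul, mul_eq_zero] at h
    exact h.elim hc.2 ((S c).gdim_ne_zero (hw c).exists_ne)
  · intro b hb hbc
    by_cases hgb : g b = 0
    · simp [hgb]
    have hle := hmax b (by simp [hb, hgb])
    rw [Finsupp.smul_apply, character_apply, gdim_eq_zero, smul_zero]
    intro y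
    by_contra hy
    exact hbc (hinj (SeqOf.key_injective (le_antisymm hle ((hw b).le _ ⟨y, hy⟩))))
  · exact fun h => absurd hc.1 h

end GrMod

end

end QuiverHecke

/-! ### Classes of irreducibles span the Grothendieck group. -/

namespace QuiverHecke

section

variable {I : Type v} [DecidableEq I] [Fintype I] {D : BorcherdsCartanDatum I}
  {K : Type u} [Field K] {n : ℕ} {ν : I →₀ ℕ}

namespace GrMod

lemma IsGradedSubmodule.proj_mem {M : GrMod D K n ν} {N : Submodule (R D K n ν) M.carrier}
    (hN : M.IsGradedSubmodule N) {d : ℤ} {p : M.carrier →ₗ[K] M.carrier}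
    (hp : ∀ x ∈ M.deg d, p x = x) (hp' : ∀ c ≠ d, ∀ x ∈ M.deg c, p x = 0) {x : M.carrier}
    (hx : x ∈ N) : p x ∈ N := by
  have h : ⨆ c, N.restrictScalars K ⊓ M.deg c ≤ (N.restrictScalars K).comap p := by
    refine iSup_le fun c x hx => ?_
    rw [Submodule.mem_comap]
    by_cases hc : c = d
    · subst hc
      rw [hp x hx.2]
      exact hx.1
    · rw [hp' c hc x hx.2]
      exact Submodule.zero_mem _
  exact h (hN hx)

/-- A graded submodule as a graded module. -/
noncomputable def sub (M : GrMod D K n ν) (N : Submodule (R D K n ν) M.carrier) (hN : M.IsGradedSubmodule N) :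
    GrMod D K n ν where
  carrier := N
  finite := Module.Finite.of_injective (N.subtype.restrictScalars K) N.injective_subtype
  deg d := (M.deg d).comap (N.subtype.restrictScalars K)
  isInternal := by
    rw [DirectSum.isInternal_submodule_iff_iSupIndep_and_iSup_eq_top]
    constructor
    · intro d
      have h := M.isInternal.submodule_iSupIndep d
      rw [Submodule.disjoint_def] at h ⊢
      intro x hx hx'
      refine Subtype.ext (h x.1 hx ?_)
      have hle : ⨆ c, ⨆ (_ : c ≠ d), (M.deg c).comap (N.subtype.restrictScalars K) ≤
          (⨆ c, ⨆ (_ : c ≠ d), M.deg c).comap (N.subtype.restrictScalars K) :=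
        iSup₂_le fun c hc => Submodule.comap_mono (le_iSup₂_of_le c hc le_rfl)
      exact hle hx'
    · refine eq_top_iff.2 fun x _ => ?_
      have hle : ⨆ d, N.restrictScalars K ⊓ M.deg d ≤
          (⨆ d, (M.deg d).comap (N.subtype.restrictScalars K)).map
            (N.subtype.restrictScalars K) := by
        refine iSup_le fun d y hy => ?_
        exact ⟨⟨y, hy.1⟩, Submodule.mem_iSup_of_mem d hy.2, rfl⟩
      obtain ⟨y, hy, hyx⟩ := hle (hN x.2)
      obtain rfl : y = x := Subtype.ext hyx
      exact hy
  smul_mem d m a x ha hx := M.smul_mem d m a x.1 ha hx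

/-- The quotient by a graded submodule as a graded module. -/
noncomputable def quot (M : GrMod D K n ν) (N : Submodule (R D K n ν) M.carrier) (hN : M.IsGradedSubmodule N) :
    GrMod D K n ν where
  carrier := M.carrier ⧸ N
  finite := Module.Finite.of_surjective (N.mkQ.restrictScalars K) N.mkQ_surjective
  deg d := (M.deg d).map (N.mkQ.restrictScalars K)
  isInternal := by
    rw [DirectSum.isInternal_submodule_iff_iSupIndep_and_iSup_eq_top]
    constructor
    · intro d
      rw [Submodule.disjoint_def]
      intro x hx hx'
      simp only [← Submodule.map_iSup] at hx'
      obtain ⟨a, ha, rfl⟩ := hx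
      obtain ⟨b, hb, hab⟩ := hx'
      obtain ⟨p, -, hp, hp'⟩ := M.exists_proj d
      have hb0 : p b = 0 := by
        have hle : ⨆ c, ⨆ (_ : c ≠ d), M.deg c ≤ LinearMap.ker p :=
          iSup₂_le fun c hc x hx => hp' c hc x hx
        exact hle hb
      have hmem : b - a ∈ N := (Submodule.Quotient.eq N).1 hab
      have := hN.proj_mem hp hp' hmem
      rw [map_sub, hb0, hp a ha, zero_sub, Submodule.neg_mem_iff] at this
      exact (Submodule.Quotient.mk_eq_zero N).2 this
    · rw [← Submodule.map_iSup, M.isInternal.submodule_iSup_eq_top, Submodule.map_top,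
        LinearMap.range_eq_top]
      exact N.mkQ_surjective
  smul_mem d m a x ha hx := by
    obtain ⟨y, hy, rfl⟩ := hx
    exact ⟨a • y, M.smul_mem d m a y ha hy, rfl⟩

lemma isShortExact_sub_quot (M : GrMod D K n ν) (N : Submodule (R D K n ν) M.carrier)
    (hN : M.IsGradedSubmodule N) :
    IsShortExact (M' := M.sub N hN) (M := M) (M'' := M.quot N hN) N.subtype N.mkQ where
  f_deg _ _ hx := hx
  g_deg _ x hx := ⟨x, hx, rfl⟩
  injective := N.injective_subtype
  exact := LinearMap.exact_subtype_mkQ N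
  surjective := N.mkQ_surjective

end GrMod

namespace G0

open GrMod

lemma mk_eq_zero (M : GrMod D K n ν) [Subsingleton M.carrier] : mk M = 0 := by
  -- For the zero module this sequence is exact and gives [M] = [M] + [M].
  have h : IsShortExact (M' := M) (M := M) (M'' := M) 0 0 :=
    ⟨fun d _ _ => (M.deg d).zero_mem, fun d _ _ => (M.deg d).zero_mem,
      Function.injective_of_subsingleton _,
      fun x => ⟨fun _ => ⟨x, Subsingleton.elim _ _⟩, fun _ => rfl⟩,
      fun x => ⟨x, Subsingleton.elim _ _⟩⟩
  simpa using mk_add h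

lemma mk_eq_of_isIso {M N : GrMod D K n ν} (h : IsIso M N) : mk M = mk N := by
  obtain ⟨f, hf⟩ := h
  have hbot : M.IsGradedSubmodule ⊥ := by
    intro x hx
    obtain rfl : x = 0 := hx
    exact Submodule.zero_mem _
  have : Subsingleton (M.sub ⊥ hbot).carrier :=
    inferInstanceAs (Subsingleton (⊥ : Submodule (R D K n ν) M.carrier))
  have hs : IsShortExact (M' := M.sub ⊥ hbot) (M := M) (M'' := N)
      (Submodule.subtype ⊥) f.toLinearMap := by
    refine ⟨fun _ _ hx => hx, fun d x hx => (hf d x).2 hx, Submodule.injective_subtype _,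
      fun x => ?_, f.surjective⟩
    constructor
    · intro hx
      exact ⟨⟨x, f.map_eq_zero_iff.1 hx⟩, rfl⟩
    · rintro ⟨y, rfl⟩
      rw [Subsingleton.elim y 0]
      exact map_zero f
  rw [mk_add hs, mk_eq_zero (M.sub ⊥ hbot), zero_add]

lemma mk_eq_smul_of_isIsoUpToShift {M N : GrMod D K n ν} (h : IsIsoUpToShift M N) :
    ∃ p : ℤ[T;T⁻¹], mk M = p • mk N := by
  obtain ⟨m, h⟩ := h
  exact ⟨LaurentPolynomial.T m, by rw [T_smul_mk, mk_eq_of_isIso h]⟩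

/-- The Grothendieck group is spanned by the classes of the gr-irreducible modules. -/
lemma mk_mem_span (M : GrMod D K n ν) :
    mk M ∈ Submodule.span ℤ[T;T⁻¹] {z | ∃ S : GrMod D K n ν, S.IsGrIrreducible ∧ z = mk S} := by
  obtain ⟨m, hm⟩ : ∃ m, Module.finrank K M.carrier = m := ⟨_, rfl⟩
  induction m using Nat.strong_induction_on generalizing M with
  | _ m ih =>
    by_cases hM : M.IsGrIrreducible
    · exact Submodule.subset_span ⟨M, hM, rfl⟩
    rcases subsingleton_or_nontrivial M.carrier with h | h
    · rw [mk_eq_zero M]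
      exact Submodule.zero_mem _
    obtain ⟨N, hN, hbot, htop⟩ : ∃ N, M.IsGradedSubmodule N ∧ N ≠ ⊥ ∧ N ≠ ⊤ := by
      by_contra! hc
      exact hM ⟨h, fun N hN => or_iff_not_imp_left.2 (hc N hN)⟩
    -- Submodule and quotient are both nonzero, so both have smaller dimension than `M`.
    have hrank := LinearMap.finrank_range_add_finrank_ker (N.mkQ.restrictScalars K)
    have hr : LinearMap.range (N.mkQ.restrictScalars K) = ⊤ :=
      LinearMap.range_eq_top.2 N.mkQ_surjective
    rw [hr, finrank_top, LinearMap.ker_restrictScalars, Submodule.ker_mkQ] at hrank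
    have h1 : 0 < Module.finrank K (M.sub N hN).carrier := by
      have : Nontrivial (M.sub N hN).carrier := (Submodule.nontrivial_iff_ne_bot).2 hbot
      exact Module.finrank_pos
    have h2 : 0 < Module.finrank K (M.quot N hN).carrier := by
      have : Nontrivial (M.quot N hN).carrier := Submodule.Quotient.nontrivial_iff.2 htop
      exact Module.finrank_pos
    change Module.finrank K (M.quot N hN).carrier + Module.finrank K (M.sub N hN).carrier = _
      at hrank
    rw [mk_add (M.isShortExact_sub_quot N hN)]
    exact Submodule.add_mem _ (ih _ (by omega) _ rfl) (ih _ (by omega) _ rfl)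

lemma span_mk_eq_top :
    Submodule.span ℤ[T;T⁻¹] {z : G0 D K n ν | ∃ S : GrMod D K n ν,
      S.IsGrIrreducible ∧ z = mk S} = ⊤ := by
  refine eq_top_iff.2 fun z _ => ?_
  obtain ⟨z, rfl⟩ := QuotientAddGroup.mk'_surjective _ z
  induction z using FreeAbelianGroup.induction_on with
  | zero => exact Submodule.zero_mem _
  | of M => exact mk_mem_span M
  | neg M h =>
    rw [map_neg]
    exact Submodule.neg_mem _ (mk_mem_span M)
  | add a b ha hb =>
    rw [map_add]
    exact Submodule.add_mem _ (ha trivial) (hb trivial)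

end G0

/-- One irreducible is chosen for each leading sequence that occurs. Every irreducible is a shift of
a chosen one, so the chosen classes span, while their characters are independent. -/
lemma Ch_injective :
    Function.Injective (Ch : G0 D K n ν →ₗ[ℤ[T;T⁻¹]] (SeqOf n ν →₀ ℤ[T;T⁻¹])) := by
  let B := {w : SeqOf n ν // ∃ M : GrMod D K n ν, M.IsGrIrreducible ∧ M.IsLeading w}
  let S : B → GrMod D K n ν := fun w => w.2.choose
  have hS : ∀ b, (S b).IsGrIrreducible := fun b => b.2.choose_spec.1
  have hw : ∀ b, (S b).IsLeading b.1 := fun b => b.2.choose_spec.2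
  have hli := GrMod.linearIndependent_character S (fun b => b.1) hw Subtype.val_injective
  have hspan : ⊤ ≤ Submodule.span ℤ[T;T⁻¹] (Set.range fun b => G0.mk (S b)) := by
    rw [← G0.span_mk_eq_top, Submodule.span_le]
    rintro _ ⟨M, hM, rfl⟩
    have := hM.1
    obtain ⟨w, hMw⟩ := M.exists_isLeading
    let b : B := ⟨w, M, hM, hMw⟩
    obtain ⟨p, hp⟩ := G0.mk_eq_smul_of_isIsoUpToShift
      (hM.isIsoUpToShift (hS b) hMw (hw b))
    rw [hp]
    exact Submodule.smul_mem _ _ (Submodule.subset_span ⟨b, rfl⟩)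
  rw [← LinearMap.ker_eq_bot, LinearMap.ker_eq_bot']
  intro z hz
  obtain ⟨c, rfl⟩ := Finsupp.mem_span_range_iff_exists_finsupp.1 (hspan (x := z) trivial)
  rw [Finsupp.sum, map_sum] at hz
  simp only [map_smul, Ch_mk] at hz
  have := linearIndependent_iff'.1 hli c.support c hz
  exact Finset.sum_eq_zero fun b hb => by simp only [this b hb, zero_smul]

end

end QuiverHecke

theorem mainTheorem3 {I : Type v} [Fintype I] [DecidableEq I] (D : BorcherdsCartanDatum I)
    (K : Type u) [Field K] [IsAlgClosed K] (n : ℕ) (ν : I →₀ ℕ) (hν : ∑ i, ν i = n) :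
    Function.Injective
      (QuiverHecke.Ch : QuiverHecke.G0 D K n ν →ₗ[LaurentPolynomial ℤ]
        (QuiverHecke.SeqOf n ν →₀ LaurentPolynomial ℤ)) ∧
    ∀ (B : Type*) (S : B → QuiverHecke.GrMod D K n ν),
      (∀ b, (S b).IsGrIrreducible) →
      (∀ b c, (S b).IsIsoUpToShift (S c) → b = c) →
      LinearIndependent (LaurentPolynomial ℤ) fun b => (S b).character := by
  refine ⟨QuiverHecke.Ch_injective, fun B S hS hne => ?_⟩
  have hw : ∀ b, ∃ w, (S b).IsLeading w := fun b =>
    have := (hS b).1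
    (S b).exists_isLeading
  choose w hw using hw
  -- Inequivalent irreducibles have distinct leading sequences, which is all that triangularity
  -- needs.
  refine QuiverHecke.GrMod.linearIndependent_character S w hw fun b c hbc => hne b c ?_
  exact (hS b).isIsoUpToShift (hS c) (hw b) (hbc ▸ hw c)
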